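/- Let $h>0$ and $\hbar=\frac{h}{2\pi}$. For a function $f$ on the phase space $\mathbb R^3_x\times\mathbb R^3_\xi$, let $\mathrm{Op}(f)$ denote its Weyl quantization, i.e. the operator on functions of $\mathbb R^3$ with integral kernel $$\mathrm{Op}(f)(x,y)=\int_{\mathbb R^3}e^{-2\pi i\,(y-x)\cdot\xi}\,f\big(\tfrac{x+y}{2},h\xi\big)\,\mathrm d\xi$$ when $f$ is integrable, extended by duality with the Wigner transform to functions that are not integrable: $$\langle\psi,\mathrm{Op}(f)\varphi\rangle=h^{-3}\int_{\mathbb R^6}f(x,\xi)\Big(\int_{\mathbb R^3}e^{-2\pi i\,\xi\cdot y/h}\varphi(x+\tfrac y2)\overline{\psi(x-\tfrac y2)}\,\mathrm dy\Big)\mathrm dx\,\mathrm d\xi$$ for Schwartz functions $\varphi,\psi$. Let $\langle\xi\rangle=\sqrt{1+|\xi|^2}$ and $\langle p\rangle=\sqrt{1+|p|^2}$ with $p=-i\hbar\nabla$, so that $\langle p\rangle=(1-\hbar^2\Delta)^{1/2}$. For a bounded operator $A$ on $L^2(\mathbb R^3)$ let $\|A\|_{\mathcal L^2}=h^{3/2}\,\mathrm{Tr}(|A|^2)^{1/2}\in[0,\infty]$;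 for an operator given by its matrix elements between Schwartz functions, $\|\cdot\|_{\mathcal L^2}$ is the norm of its bounded extension to $L^2(\mathbb R^3)$, and $\infty$ if there is none. Let $f\in H^1(\mathbb R^3_x\times\mathbb R^3_\xi)$. Then $$\|\mathrm{Op}(\langle\xi\rangle f)-\mathrm{Op}(f)\langle p\rangle\|_{\mathcal L^2}\le\frac{\hbar}{2}\|\nabla_xf\|_{L^2},\qquad \|\mathrm{Op}(\langle\xi\rangle f)-\langle p\rangle\mathrm{Op}(f)\|_{\mathcal L^2}\le\frac{\hbar}{2}\|\nabla_xf\|_{L^2},$$ and $$\|\langle p\rangle\mathrm{Op}(f)\langle p\rangle-\mathrm{Op}(\langle\xi\rangle^2f)\|_{\mathcal L^2}\le\frac{\hbar^2}{4}\|\Delta_xf\|_{L^2},$$ where the right-hand side of the last inequality is $\infty$ if the distribution $\Delta_xf$ is not in $L^2$. -/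

import Mathlib

open MeasureTheory
open scoped ENNReal SchwartzMap ContDiff FourierTransform InnerProductSpace ComplexConjugate

noncomputable section

namespace WeylWeight

/-- Position (or momentum) space `ℝ³` with its Euclidean structure. -/
abbrev X : Type := EuclideanSpace ℝ (Fin 3)

/-- Phase space `ℝ³ × ℝ³`, points `z = (x, ξ)`, with the product Lebesgue measure. -/
abbrev Phase : Type := X × X

/-- The Hilbert space `L²(ℝ³; ℂ)`. -/
abbrev L2X : Type := Lp ℂ 2 (volume : Measure X)

/-- Bounded operators on `L²(ℝ³; ℂ)`. -/
abbrev BddOp : Type := L2X →L[ℂ] L2X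

/-- `ħ = h / (2π)`. -/
def hbar (h : ℝ) : ℝ := h / (2 * Real.pi)

/-- The Japanese bracket `⟨v⟩ = (1 + |v|²)^{1/2}`. -/
def bracket (v : X) : ℝ := Real.sqrt (1 + ‖v‖ ^ 2)

/-! ### Weak derivatives on phase space -/

/-- Test functions on phase space. -/
def IsTest (χ : Phase → ℝ) : Prop := ContDiff ℝ ∞ χ ∧ HasCompactSupport χ

/-- `g` is the weak derivative of `f` in the direction `v`. -/
def IsWeakDeriv (v : Phase) (f g : Phase → ℂ) : Prop :=
  LocallyIntegrable f volume ∧ LocallyIntegrable g volume ∧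
    ∀ χ : Phase → ℝ, IsTest χ →
      ∫ z, ((fderiv ℝ χ z v : ℝ) : ℂ) * f z = - ∫ z, (χ z : ℂ) * g z

/-- The `i`-th coordinate vector in the `x` variable. -/
def dirX (i : Fin 3) : Phase := (EuclideanSpace.single i 1, 0)

/-- The `i`-th coordinate vector in the `ξ` variable. -/
def dirXi (i : Fin 3) : Phase := (0, EuclideanSpace.single i 1)

/-- The Sobolev space `H¹` of the phase space: `f` and its six first order weak derivatives are
in `L²`. -/
def MemH1 (f : Phase → ℂ) : Prop :=
  MemLp f 2 volume ∧
    (∀ i, ∃ g, IsWeakDeriv (dirX i) f g ∧ MemLp g 2 volume) ∧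
    (∀ i, ∃ g, IsWeakDeriv (dirXi i) f g ∧ MemLp g 2 volume)

/-- `G` is the weak gradient `∇ₓ f`. -/
def IsWeakGradX (f : Phase → ℂ) (G : Phase → EuclideanSpace ℂ (Fin 3)) : Prop :=
  ∀ i, IsWeakDeriv (dirX i) f (fun z => G z i)

/-- `g` is the distributional Laplacian `Δₓ f` in the variable `x` (assumed to be a locally
integrable function). -/
def IsWeakLaplacianX (f g : Phase → ℂ) : Prop :=
  LocallyIntegrable f volume ∧ LocallyIntegrable g volume ∧
    ∀ χ : Phase → ℝ, IsTest χ →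
      ∫ z, ((∑ i : Fin 3, fderiv ℝ (fun w => fderiv ℝ χ w (dirX i)) z (dirX i) : ℝ) : ℂ) * f z
        = ∫ z, (χ z : ℂ) * g z

/-- The `L²` norm of `Δₓ f` on phase space, with value `∞` if the distribution `Δₓ f` is not
in `L²`. -/
def normLaplacianX (f : Phase → ℂ) : ℝ≥0∞ :=
  ⨅ (g : Phase → ℂ) (_ : IsWeakLaplacianX f g), eLpNorm g 2 volume

/-- The `L²` norm of `∇ₓ f` on phase space, with value `∞` if the distribution `∇ₓ f` is not
in `L²`. -/
def normGradX (f : Phase → ℂ) : ℝ≥0∞ :=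
  ⨅ (G : Phase → EuclideanSpace ℂ (Fin 3)) (_ : IsWeakGradX f G), eLpNorm G 2 volume

/-! ### Operators from Schwartz functions to tempered distributions -/

/-- An operator `T` defined on Schwartz functions with values in (antilinear functionals on)
Schwartz functions, recorded through its matrix elements `T φ ψ = ⟨ψ, T φ⟩`. -/
abbrev WeakOp : Type := 𝓢(X, ℂ) → 𝓢(X, ℂ) → ℂ

/-- The Wigner transform of the operator with integral kernel `k`. -/
def wigner (h : ℝ) (k : X → X → ℂ) (z : Phase) : ℂ :=
  ∫ y : X, Complex.exp (-2 * Real.pi * Complex.I * ((⟪z.2, y⟫_ℝ / h : ℝ) : ℂ)) *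
    k (z.1 + (1 / 2 : ℝ) • y) (z.1 - (1 / 2 : ℝ) • y)

/-- The Weyl quantization `Op(f)` of a function `f` on phase space (of any polynomial growth, in
the `L²` average sense), defined by duality with the Wigner transform:
`⟨ψ, Op(f) φ⟩ = h⁻³ ∫ f · W(|φ⟩⟨ψ|) dz`.
For integrable `f`, this is the operator with the usual integral kernel, see `weyl_eq_kernel`. -/
def weyl (h : ℝ) (f : Phase → ℂ) : WeakOp := fun φ ψ =>
  ((h ^ 3)⁻¹ : ℝ) * ∫ z : Phase, f z * wigner h (fun x y => φ x * conj (ψ y)) z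

/-- The integral kernel of the Weyl quantization of an integrable function. -/
def weylKernel (h : ℝ) (f : Phase → ℂ) (x y : X) : ℂ :=
  ∫ ξ : X, Complex.exp (-2 * Real.pi * Complex.I * ((⟪y - x, ξ⟫_ℝ : ℝ) : ℂ)) *
    f ((1 / 2 : ℝ) • (x + y), h • ξ)

/-- The operator `⟨p⟩ = (1 + |p|²)^{1/2}`, `p = -iħ∇`, on Schwartz functions: the Fourier
multiplier by `⟨hζ⟩`, the Fourier transform being `∫ e^{-2πi x·ζ} φ(x) dx`. -/
def bracketP (h : ℝ) : 𝓢(X, ℂ) →L[ℂ] 𝓢(X, ℂ) :=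
  SchwartzMap.fourierMultiplierCLM ℂ (fun ζ : X => ((bracket (h • ζ) : ℝ) : ℂ))

/-- `T ⟨p⟩`. -/
def mulBracketP (h : ℝ) (T : WeakOp) : WeakOp := fun φ ψ => T (bracketP h φ) ψ

/-- `⟨p⟩ T`, where `⟨p⟩` is moved to the other side of the pairing, as it is symmetric. -/
def bracketPMul (h : ℝ) (T : WeakOp) : WeakOp := fun φ ψ => T φ (bracketP h ψ)

/-! ### The semiclassical Hilbert-Schmidt norm -/

section HilbertSchmidt

variable {H : Type*} [NormedAddCommGroup H] [InnerProductSpace ℂ H]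

theorem enorm_sq_eq_tsum {ι : Type*} (b : HilbertBasis ι ℂ H) (x : H) :
    ‖x‖ₑ ^ 2 = ∑' i, ‖⟪b i, x⟫_ℂ‖ₑ ^ 2 := by
  have h1 := b.hasSum_inner_mul_inner x x
  have h2 : HasSum (fun i => ‖⟪b i, x⟫_ℂ‖ ^ 2) (‖x‖ ^ 2) := by
    have h3 := RCLike.hasSum_re (𝕜 := ℂ) h1
    rw [inner_self_eq_norm_sq] at h3
    convert h3 using 2 with i
    rw [← inner_conj_symm x (b i), RCLike.conj_mul]
    norm_cast
  have h4 : ∀ y : H, ‖y‖ₑ ^ 2 = ENNReal.ofReal (‖y‖ ^ 2) := fun y => by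
    rw [← ofReal_norm, ENNReal.ofReal_pow (norm_nonneg _)]
  have h5 : ∀ y : ℂ, ‖y‖ₑ ^ 2 = ENNReal.ofReal (‖y‖ ^ 2) := fun y => by
    rw [← ofReal_norm, ENNReal.ofReal_pow (norm_nonneg _)]
  simp_rw [h4, h5]
  rw [← h2.tsum_eq, ENNReal.ofReal_tsum_of_nonneg (fun _ => by positivity) h2.summable]

variable [CompleteSpace H]

/-- The trace of a nonnegative bounded operator, computed in some Hilbert basis. -/
def trace (T : H →L[ℂ] H) : ℝ≥0∞ :=
  ∑' e : (exists_hilbertBasis ℂ H).choose,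
    ENNReal.ofReal (RCLike.re ⟪(e : H), T (e : H)⟫_ℂ)

/-- The Schatten norm `Tr(|A|²)^{1/2}`, with `|A| = √(A* A)`. -/
def schattenTwo (A : H →L[ℂ] H) : ℝ≥0∞ := (trace (CFC.abs A ^ 2)) ^ (1 / 2 : ℝ)

theorem tsum_enorm_adjoint {ι κ : Type*} (b : HilbertBasis ι ℂ H) (c : HilbertBasis κ ℂ H)
    (A : H →L[ℂ] H) : ∑' i, ‖A (b i)‖ₑ ^ 2 = ∑' j, ‖star A (c j)‖ₑ ^ 2 := by
  simp_rw [enorm_sq_eq_tsum c (A (b _)), enorm_sq_eq_tsum b (star A (c _))]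
  rw [ENNReal.tsum_comm]
  refine tsum_congr fun j => tsum_congr fun i => ?_
  rw [ContinuousLinearMap.star_eq_adjoint, ContinuousLinearMap.adjoint_inner_right,
    ← inner_conj_symm, RCLike.enorm_conj]

/-- The Hilbert-Schmidt norm can be computed in any Hilbert basis. -/
theorem schattenTwo_eq {ι : Type*} (b : HilbertBasis ι ℂ H) (A : H →L[ℂ] H) :
    schattenTwo A = (∑' i, ‖A (b i)‖ₑ ^ 2) ^ (1 / 2 : ℝ) := by
  obtain ⟨c, hc⟩ := (exists_hilbertBasis ℂ H).choose_spec
  rw [tsum_enorm_adjoint b c A, ← tsum_enorm_adjoint c c A, schattenTwo, trace]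
  congr 1
  refine tsum_congr fun e => ?_
  rw [CFC.abs_sq, hc, mul_apply_eq_comp, ContinuousLinearMap.star_eq_adjoint,
    ContinuousLinearMap.adjoint_inner_right, inner_self_eq_norm_sq, ← ofReal_norm,
    ENNReal.ofReal_pow (norm_nonneg _)]

end HilbertSchmidt

/-- The rescaled Schatten norm `h^{3/2} Tr(|A|²)^{1/2}` of a bounded operator on `L²`. -/
def semiclassicalTwo (h : ℝ) (A : BddOp) : ℝ≥0∞ :=
  ENNReal.ofReal (h ^ (3 / 2 : ℝ)) * schattenTwo A

/-- The bounded operator `A` on `L²` extends `T`. -/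
def Extends (A : BddOp) (T : WeakOp) : Prop :=
  ∀ φ ψ : 𝓢(X, ℂ), ⟪ψ.toLp 2 volume, A (φ.toLp 2 volume)⟫_ℂ = T φ ψ

/-- The rescaled Schatten norm of an operator defined on Schwartz functions: it is that of its
(unique) bounded extension to `L²`, and `∞` if there is no such extension. -/
def weakOpNorm (h : ℝ) (T : WeakOp) : ℝ≥0∞ :=
  ⨅ (A : BddOp) (_ : Extends A T), semiclassicalTwo h A

/-! ### Consistency of the definitions -/

theorem bracket_hasTemperateGrowth (h : ℝ) :
    (fun ζ : X => ((bracket (h • ζ) : ℝ) : ℂ)).HasTemperateGrowth := by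
  have h1 : (fun v : X => bracket v) = fun v : X => (1 + ‖v‖ ^ 2) ^ (1 / 2 : ℝ) := by
    funext v
    rw [bracket, Real.sqrt_eq_rpow]
  have h2 : (fun v : X => bracket v).HasTemperateGrowth := by
    rw [h1]; exact Function.hasTemperateGrowth_one_add_norm_sq_rpow X _
  have h3 : (fun ζ : X => h • ζ).HasTemperateGrowth :=
    (h • ContinuousLinearMap.id ℝ X).hasTemperateGrowth
  have h4 : (fun ζ : X => bracket (h • ζ)).HasTemperateGrowth := h2.comp h3
  exact Function.Complex.hasTemperateGrowth_ofReal.comp h4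

/-- `⟨p⟩² = 1 - ħ²Δ`. -/
theorem bracketP_sq (h : ℝ) (φ : 𝓢(X, ℂ)) :
    bracketP h (bracketP h φ) = φ - (hbar h ^ 2) • Laplacian.laplacian φ := by
  have hg := bracket_hasTemperateGrowth h
  rw [bracketP, SchwartzMap.fourierMultiplierCLM_fourierMultiplierCLM_apply hg hg,
    SchwartzMap.laplacian_eq_fourierMultiplierCLM]
  have hn : (fun ζ : X => ‖ζ‖ ^ 2).HasTemperateGrowth := Function.hasTemperateGrowth_norm_sq X
  refine (FourierTransform.fourierCLE ℂ 𝓢(X, ℂ)).injective ?_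
  ext ζ
  have h2 : (bracket (h • ζ)) ^ 2 = 1 + h ^ 2 * ‖ζ‖ ^ 2 := by
    rw [bracket, Real.sq_sqrt (by positivity), norm_smul, mul_pow, Real.norm_eq_abs, sq_abs]
  have h3 : hbar h ^ 2 * (2 * Real.pi) ^ 2 = h ^ 2 := by
    rw [hbar, div_pow]; field_simp
  have hl : SchwartzMap.smulLeftCLM ℂ ((‖·‖ ^ 2 : X → ℝ)) (𝓕 φ) ζ = (‖ζ‖ ^ 2) • (𝓕 φ) ζ :=
    SchwartzMap.smulLeftCLM_apply_apply hn (𝓕 φ) ζ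
  simp only [FourierTransform.fourierCLE_apply, SchwartzMap.fourierMultiplierCLM_apply,
    sub_eq_add_neg, neg_smul, smul_neg, neg_neg, FourierTransform.fourier_add,
    FourierTransform.fourier_smul, FourierTransform.fourier_fourierInv_eq, add_apply,
    smul_apply, SchwartzMap.smulLeftCLM_apply_apply (hg.mul hg), Pi.mul_apply]
  erw [hl]
  simp only [Complex.real_smul, smul_eq_mul]
  have h4 : ((bracket (h • ζ) : ℝ) : ℂ) * (bracket (h • ζ) : ℝ)
      = 1 + ((hbar h ^ 2 * (2 * Real.pi) ^ 2 : ℝ) : ℂ) * ((‖ζ‖ ^ 2 : ℝ) : ℂ) := by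
    rw [h3, ← Complex.ofReal_mul, ← sq, h2]; push_cast; ring
  rw [h4]; push_cast; ring

/-- An operator on Schwartz functions has at most one bounded extension. -/
theorem Extends.unique {A B : BddOp} {T : WeakOp} (hA : Extends A T) (hB : Extends B T) :
    A = B := by
  have hd : DenseRange (fun φ : 𝓢(X, ℂ) => φ.toLp 2 (volume : Measure X)) :=
    SchwartzMap.denseRange_toLpCLM (F := ℂ) (E := X) (p := 2) (by norm_num)
  refine ContinuousLinearMap.ext fun x => ?_
  refine congrFun (hd.equalizer A.continuous B.continuous ?_) x
  funext φ
  refine ext_inner_left ℂ fun y => ?_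
  have h1 : Continuous fun y : L2X => ⟪y, A (φ.toLp 2 volume)⟫_ℂ := by fun_prop
  have h2 : Continuous fun y : L2X => ⟪y, B (φ.toLp 2 volume)⟫_ℂ := by fun_prop
  refine congrFun (hd.equalizer h1 h2 ?_) y
  funext ψ
  exact (hA φ ψ).trans (hB φ ψ).symm

theorem weakOpNorm_eq (h : ℝ) {A : BddOp} {T : WeakOp} (hA : Extends A T) :
    weakOpNorm h T = semiclassicalTwo h A := by
  apply le_antisymm
  · exact iInf₂_le A hA
  · exact le_iInf₂ fun B hB => by rw [hA.unique hB]

/-- For integrable `f`, `Op(f)` is the operator with integral kernel `weylKernel h f`. -/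
theorem weyl_eq_kernel {h : ℝ} (hh : 0 < h) {f : Phase → ℂ} (hf : Integrable f volume)
    (φ ψ : 𝓢(X, ℂ)) :
    weyl h f φ ψ = ∫ x : X, conj (ψ x) * ∫ y : X, weylKernel h f x y * φ y := by
  -- the phase of the kernel
  set e : ℝ → ℂ := fun t => Complex.exp (-2 * Real.pi * Complex.I * (t : ℂ)) with he
  have he1 : ∀ t, ‖e t‖ = 1 := fun t => by
    have : -2 * Real.pi * Complex.I * (t : ℂ) = ((-2 * Real.pi * t : ℝ) : ℂ) * Complex.I := by
      push_cast; ring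
    rw [he]; simp only [this, Complex.norm_exp_ofReal_mul_I]
  have hec : Continuous e := by rw [he]; fun_prop
  obtain ⟨Cψ, hCψ⟩ : ∃ C, ∀ x, ‖ψ x‖ ≤ C :=
    ⟨_, fun x => ψ.norm_le_seminorm ℝ x⟩
  have hφi : Integrable (fun x => φ x) volume := φ.integrable
  have : (volume : Measure Phase).IsAddLeftInvariant :=
    inferInstanceAs ((volume : Measure X).prod (volume : Measure X)).IsAddLeftInvariant
  -- the integrand in the variables `(y, (x, ξ))`
  let H : X × Phase → ℂ := fun q => e (⟪q.2.2, q.1⟫_ℝ / h) * f q.2 *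
    (φ (q.2.1 + (1 / 2 : ℝ) • q.1) * conj (ψ (q.2.1 - (1 / 2 : ℝ) • q.1)))
  have hbase : Integrable (fun q : X × Phase => f q.2 * φ (q.2.1 + (1 / 2 : ℝ) • q.1))
      (volume.prod volume) := by
    have hm : AEStronglyMeasurable (fun q : X × Phase => f q.2 * φ (q.2.1 + (1 / 2 : ℝ) • q.1))
        ((volume : Measure X).prod (volume : Measure Phase)) := by
      refine (hf.1.comp_snd).mul (Continuous.aestronglyMeasurable ?_)
      exact φ.continuous.comp (by fun_prop)
    have hi : ∀ x : X, Integrable (fun y : X => φ (x + (1 / 2 : ℝ) • y)) volume := fun x => by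
      have := (hφi.comp_add_left x).comp_smul (R := (1 / 2 : ℝ)) (by norm_num)
      exact this
    refine (integrable_prod_iff' hm).2 ⟨Filter.Eventually.of_forall fun z => ?_, ?_⟩
    · exact (hi z.1).const_mul (f z)
    · have hc : ∀ x : X, ∫ y : X, ‖φ (x + (1 / 2 : ℝ) • y)‖ = ∫ y : X, ‖φ ((1 / 2 : ℝ) • y)‖ := by
        intro x
        have h2 := integral_add_left_eq_self (μ := (volume : Measure X))
          (fun y : X => ‖φ ((1 / 2 : ℝ) • y)‖) ((2 : ℝ) • x)
        rw [← h2]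
        congr 1
        funext y
        rw [smul_add, smul_smul]; norm_num
      simp_rw [norm_mul, integral_const_mul, hc]
      exact hf.norm.mul_const _
  have hH : Integrable H (volume.prod volume) := by
    have hb : Continuous fun q : X × Phase =>
        e (⟪q.2.2, q.1⟫_ℝ / h) * conj (ψ (q.2.1 - (1 / 2 : ℝ) • q.1)) := by
      refine (hec.comp (by fun_prop)).mul (Complex.continuous_conj.comp (ψ.continuous.comp ?_))
      fun_prop
    refine (hbase.bdd_mul (c := Cψ) hb.aestronglyMeasurable
      (Filter.Eventually.of_forall fun q => ?_)).congr (Filter.Eventually.of_forall fun q => ?_)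
    · rw [norm_mul, he1, one_mul, RCLike.norm_conj]; exact hCψ _
    · simp only [H]; ring
  -- the shifted integrand
  let H' : X × Phase → ℂ := fun q => e (⟪q.2.2, q.1⟫_ℝ / h) *
    f ((1 / 2 : ℝ) • q.1 + q.2.1, q.2.2) * (φ (q.2.1 + q.1) * conj (ψ q.2.1))
  have hshift : MeasurePreserving
      (fun q : X × Phase => (q.1, (((1 / 2 : ℝ) • q.1, (0 : X)) : Phase) + q.2))
      (volume.prod volume) (volume.prod volume) :=
    (MeasurePreserving.id (volume : Measure X)).skew_product
      (g := fun y z => (((1 / 2 : ℝ) • y, (0 : X)) : Phase) + z) (by fun_prop)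
      (Filter.Eventually.of_forall fun y => map_add_left_eq_self _ _)
  have hHH' : ∀ q : X × Phase, H (q.1, (((1 / 2 : ℝ) • q.1, (0 : X)) : Phase) + q.2) = H' q := by
    rintro ⟨y, x, ξ⟩
    have h1 : (1 / 2 : ℝ) • y + x + (1 / 2 : ℝ) • y = x + y := by module
    have h2 : (1 / 2 : ℝ) • y + x - (1 / 2 : ℝ) • y = x := by module
    simp only [H, H', Prod.mk_add_mk, zero_add, h1, h2]
  have hH' : Integrable H' (volume.prod volume) := by
    have := hshift.integrable_comp_of_integrable hH
    exact this.congr (Filter.Eventually.of_forall fun q => hHH' q)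
  have hK : ∀ x y : X, ∫ ξ : X, H' (y, (x, ξ)) =
      (h ^ 3 : ℝ) * (weylKernel h f x (x + y) * (φ (x + y) * conj (ψ x))) := by
    intro x y
    have h1 := Measure.integral_comp_smul (volume : Measure X) (fun ξ => H' (y, (x, ξ))) h
    have hd : Module.finrank ℝ X = 3 := by simp
    have h2 : ∫ ξ : X, H' (y, (x, h • ξ)) =
        weylKernel h f x (x + y) * (φ (x + y) * conj (ψ x)) := by
      rw [weylKernel, ← integral_mul_const]
      congr 1
      funext ξ
      have h3 : ⟪h • ξ, y⟫_ℝ / h = ⟪x + y - x, ξ⟫_ℝ := by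
        rw [add_sub_cancel_left, real_inner_smul_left, real_inner_comm]; field_simp
      have h4 : (1 / 2 : ℝ) • y + x = (1 / 2 : ℝ) • (x + (x + y)) := by module
      simp only [H', h3, h4, he]
    rw [← h2, h1, hd, abs_of_pos (by positivity), Complex.real_smul, ← mul_assoc,
      ← Complex.ofReal_mul, mul_inv_cancel₀ (by positivity), Complex.ofReal_one, one_mul]
  have hG : Integrable (fun p : X × X => ∫ ξ : X, H' (p.1, (p.2, ξ))) (volume.prod volume) := by
    have := (measurePreserving_prodAssoc (volume : Measure X) (volume : Measure X)
      (volume : Measure X)).integrable_comp_of_integrable hH'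
    exact this.integral_prod_left
  have hh3 : (((h ^ 3)⁻¹ : ℝ) : ℂ) * ((h ^ 3 : ℝ) : ℂ) = 1 := by
    rw [← Complex.ofReal_mul, inv_mul_cancel₀ (by positivity), Complex.ofReal_one]
  calc weyl h f φ ψ
      = ((h ^ 3)⁻¹ : ℝ) * ∫ z : Phase, ∫ y : X, H (y, z) := by
        rw [weyl]
        congr 2
        funext z
        rw [wigner, ← integral_const_mul]
        congr 1
        funext y
        simp only [H, he]
        ring
    _ = ((h ^ 3)⁻¹ : ℝ) * ∫ y : X, ∫ z : Phase, H (y, z) := by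
        rw [integral_integral_swap (f := fun z y => H (y, z)) hH.swap]
    _ = ((h ^ 3)⁻¹ : ℝ) * ∫ y : X, ∫ z : Phase, H' (y, z) := by
        congr 2
        funext y
        rw [← integral_add_left_eq_self _ ((((1 / 2 : ℝ) • y, (0 : X)) : Phase))]
        congr 1
        funext z
        exact hHH' (y, z)
    _ = ((h ^ 3)⁻¹ : ℝ) * ∫ y : X, ∫ x : X, ∫ ξ : X, H' (y, (x, ξ)) := by
        congr 1
        refine integral_congr_ae ?_
        filter_upwards [hH'.prod_right_ae] with y hy
        exact integral_prod _ hy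
    _ = ((h ^ 3)⁻¹ : ℝ) * ∫ x : X, ∫ y : X, ∫ ξ : X, H' (y, (x, ξ)) := by
        rw [integral_integral_swap (f := fun y x => ∫ ξ : X, H' (y, (x, ξ))) hG]
    _ = ∫ x : X, conj (ψ x) * ∫ y : X, weylKernel h f x y * φ y := by
        simp_rw [hK, integral_const_mul]
        rw [← mul_assoc, hh3, one_mul]
        congr 1
        funext x
        rw [integral_add_left_eq_self (μ := (volume : Measure X))
          (fun y => weylKernel h f x y * (φ y * conj (ψ x))) x, ← integral_const_mul]
        congr 1
        funext y
        ring

end WeylWeight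

end

/-! At fixed momentum `ξ`, the Wigner transform of `φ ⊗ ψ̄` is the inverse Fourier transform in `x`
of `φ̂(ξ/h + η/2) · conj ψ̂(ξ/h - η/2)`, the `wignerSymbol`. Applying `⟨p⟩` to `φ` or to `ψ`
multiplies this symbol by `⟨ξ + hη/2⟩` or `⟨ξ - hη/2⟩`. Each of the three operators therefore arises
from `f` by inserting an explicit multiplier `m(ξ, η)`: `⟨ξ⟩ - ⟨ξ ± hη/2⟩` in the first two cases,
`⟨ξ + hη/2⟩⟨ξ - hη/2⟩ - ⟨ξ⟩²` in the third.

The bracket is 1-Lipschitz, so the first two multipliers are at most `h|η|/2 = (ħ/2) · 2π|η|`. The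
third is at most `h²|η|²/4 = (ħ²/4)(2π|η|)²`, by `abs_bracket_mul_sub_le`. By Plancherel in `x` on
almost every fiber, the weights `2π|η|` and `(2π|η|)²` on the transform of `f` give the norms of
`∇ₓf` and `Δₓf`.

The Hilbert-Schmidt norm is reached by duality. Cauchy-Schwarz in `η` and then in `ξ` bounds the
pairing with any finite sum `∑ cᵢ φᵢ ⊗ ψ̄ᵢ` by the `L²` norm of that tensor
(`enorm_sum_symbol_sq_le`). A form bounded in this sense comes from a bounded operator whose
Hilbert-Schmidt norm obeys the same bound (`TensorBound.exists_operator`,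
`TensorBound.schattenTwo_le`); `weakOpNorm_le_of_symbol` combines these facts. -/

noncomputable section

namespace WeylWeight

/-! ### Hilbert-Schmidt operators from forms bounded on finite tensors. -/

section HilbertSchmidtExtension

variable {H S : Type} [NormedAddCommGroup H] [InnerProductSpace ℂ H]
  [AddCommGroup S] [Module ℂ S]

/-- The sesquilinear form `T`, seen as a functional on elementary tensors `φ ⊗ ψ̄`, is bounded by
`C` with respect to the norm of the Hilbert space tensor product. -/
def TensorBound (D : S →ₗ[ℂ] H) (T : S → S → ℂ) (C : ℝ) : Prop :=
  ∀ (ι : Type) [Fintype ι] (c : ι → ℂ) (φ ψ : ι → S),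
    ‖∑ i, c i * T (φ i) (ψ i)‖ ^ 2 ≤ C ^ 2 *
      (∑ i, ∑ l, c i * conj (c l) * (⟪D (φ l), D (φ i)⟫_ℂ * ⟪D (ψ i), D (ψ l)⟫_ℂ)).re

variable {D : S →ₗ[ℂ] H} {T : S → S → ℂ} {C : ℝ}

/-- No linearity of `T` is assumed. The bound forces `T` to respect every relation between
elementary tensors, and sesquilinearity follows by applying this to tensors that vanish identically.
-/
theorem TensorBound.eq_zero {ι : Type} [Fintype ι] (hT : TensorBound D T C) {c : ι → ℂ}
    {φ ψ : ι → S}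
    (h : ∑ i, ∑ l, c i * conj (c l) * (⟪D (φ l), D (φ i)⟫_ℂ * ⟪D (ψ i), D (ψ l)⟫_ℂ) = 0) :
    ∑ i, c i * T (φ i) (ψ i) = 0 := by
  have h1 := hT ι c φ ψ
  rw [h, Complex.zero_re, mul_zero] at h1
  exact norm_eq_zero.1 (pow_eq_zero_iff two_ne_zero |>.1 (le_antisymm h1 (by positivity)))

theorem TensorBound.add_left (hT : TensorBound D T C) (φ φ' ψ : S) :
    T (φ + φ') ψ = T φ ψ + T φ' ψ := by
  have := hT.eq_zero (c := ![1, -1, -1]) (φ := ![φ + φ', φ, φ']) (ψ := ![ψ, ψ, ψ]) (by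
    simp [Fin.sum_univ_three]; ring)
  simp [Fin.sum_univ_three] at this
  linear_combination this

theorem TensorBound.add_right (hT : TensorBound D T C) (φ ψ ψ' : S) :
    T φ (ψ + ψ') = T φ ψ + T φ ψ' := by
  have := hT.eq_zero (c := ![1, -1, -1]) (φ := ![φ, φ, φ]) (ψ := ![ψ + ψ', ψ, ψ']) (by
    simp [Fin.sum_univ_three]; ring)
  simp [Fin.sum_univ_three] at this
  linear_combination this

theorem TensorBound.smul_left (hT : TensorBound D T C) (a : ℂ) (φ ψ : S) :
    T (a • φ) ψ = a * T φ ψ := by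
  have := hT.eq_zero (c := ![1, -a]) (φ := ![a • φ, φ]) (ψ := ![ψ, ψ]) (by
    simp [Fin.sum_univ_two]; ring)
  simp [Fin.sum_univ_two] at this
  linear_combination this

theorem TensorBound.smul_right (hT : TensorBound D T C) (a : ℂ) (φ ψ : S) :
    T φ (a • ψ) = conj a * T φ ψ := by
  have := hT.eq_zero (c := ![1, -conj a]) (φ := ![φ, φ]) (ψ := ![a • ψ, ψ]) (by
    simp [Fin.sum_univ_two]; ring)
  simp [Fin.sum_univ_two] at this
  linear_combination this

theorem TensorBound.norm_le (hT : TensorBound D T C) (hC : 0 ≤ C) (φ ψ : S) :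
    ‖T φ ψ‖ ≤ C * ‖D φ‖ * ‖D ψ‖ := by
  have h1 := hT Unit (fun _ => 1) (fun _ => φ) (fun _ => ψ)
  simp only [Finset.univ_unique, Finset.sum_singleton, one_mul, map_one,
    inner_self_eq_norm_sq_to_K] at h1
  have h2 : (((‖D φ‖ : ℝ) : ℂ) ^ 2 * ((‖D ψ‖ : ℝ) : ℂ) ^ 2).re = ‖D φ‖ ^ 2 * ‖D ψ‖ ^ 2 := by
    norm_cast
  erw [h2] at h1
  refine (sq_le_sq₀ (norm_nonneg _) (by positivity)).1 ?_
  linarith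

variable [CompleteSpace H]

/-- A form on a dense subspace that is bounded on tensors is the form of a bounded operator. -/
theorem TensorBound.exists_operator (hT : TensorBound D T C) (hC : 0 ≤ C) (hD : DenseRange D) :
    ∃ A : H →L[ℂ] H, ∀ φ ψ, ⟪D ψ, A (D φ)⟫_ℂ = T φ ψ := by
  -- Conjugation makes the form linear in `ψ`. Riesz representation of its extension yields the
  -- vector `a φ`, and the map `φ ↦ a φ` is then extended by density in turn.
  let ℓ : S → S →ₗ[ℂ] ℂ := fun φ =>
    { toFun := fun ψ => conj (T φ ψ)
      map_add' := fun ψ ψ' => by rw [hT.add_right, map_add]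
      map_smul' := fun a ψ => by rw [hT.smul_right, map_mul, Complex.conj_conj]; rfl }
  have hℓ : ∀ φ ψ, ‖ℓ φ ψ‖ ≤ C * ‖D φ‖ * ‖D ψ‖ := fun φ ψ => by
    simpa [ℓ] using hT.norm_le hC φ ψ
  let a : S → H := fun φ => (InnerProductSpace.toDual ℂ H).symm ((ℓ φ).extendOfNorm D)
  have ha : ∀ φ ψ, ⟪D ψ, a φ⟫_ℂ = T φ ψ := fun φ ψ => by
    rw [← inner_conj_symm, InnerProductSpace.toDual_symm_apply,
      LinearMap.extendOfNorm_eq hD ⟨_, hℓ φ⟩]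
    simp [ℓ]
  have hext : ∀ x y : H, (∀ ψ, ⟪D ψ, x⟫_ℂ = ⟪D ψ, y⟫_ℂ) → x = y := fun x y hxy => by
    refine ext_inner_left ℂ fun z => ?_
    have h1 : Continuous fun z : H => ⟪z, x⟫_ℂ := by fun_prop
    have h2 : Continuous fun z : H => ⟪z, y⟫_ℂ := by fun_prop
    exact congrFun (hD.equalizer h1 h2 (funext hxy)) z
  let A₀ : S →ₗ[ℂ] H :=
    { toFun := a
      map_add' := fun φ φ' => hext _ _ fun ψ => by simp only [inner_add_right, ha, hT.add_left]
      map_smul' := fun c φ => hext _ _ fun ψ => by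
        simp only [inner_smul_right, ha, hT.smul_left, RingHom.id_apply] }
  have hA₀ : ∀ φ, ‖A₀ φ‖ ≤ C * ‖D φ‖ := fun φ => by
    change ‖(InnerProductSpace.toDual ℂ H).symm ((ℓ φ).extendOfNorm D)‖ ≤ _
    rw [LinearIsometryEquiv.norm_map]
    exact LinearMap.opNorm_extendOfNorm_le hD (by positivity) (hℓ φ)
  refine ⟨A₀.extendOfNorm D, fun φ ψ => ?_⟩
  rw [LinearMap.extendOfNorm_eq hD ⟨C, hA₀⟩]
  exact ha φ ψ

/-- The extension of a form that is bounded on tensors is a Hilbert-Schmidt operator. -/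
theorem TensorBound.schattenTwo_le (hT : TensorBound D T C) (hC : 0 ≤ C) (hD : DenseRange D)
    {A : H →L[ℂ] H} (hA : ∀ φ ψ, ⟪D ψ, A (D φ)⟫_ℂ = T φ ψ) :
    schattenTwo A ≤ ENNReal.ofReal C := by
  -- Both sides are continuous in the vectors, so the tensor bound passes from the dense image of
  -- `D` to all of `H`. Coefficients equal to `1` suffice for what follows.
  have key : ∀ (ι : Type) [Fintype ι] (u v : ι → H), ‖∑ i, ⟪v i, A (u i)⟫_ℂ‖ ^ 2 ≤ C ^ 2 *
      (∑ i, ∑ l, ⟪u l, u i⟫_ℂ * ⟪v i, v l⟫_ℂ).re := by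
    intro ι _ u v
    have hd : DenseRange (Prod.map (Pi.map fun _ : ι => D) (Pi.map fun _ : ι => D)) :=
      (DenseRange.piMap fun _ => hD).prodMap (DenseRange.piMap fun _ => hD)
    refine hd.induction_on (p := fun w : (ι → H) × (ι → H) =>
      ‖∑ i, ⟪w.2 i, A (w.1 i)⟫_ℂ‖ ^ 2 ≤ C ^ 2 *
      (∑ i, ∑ l, ⟪w.1 l, w.1 i⟫_ℂ * ⟪w.2 i, w.2 l⟫_ℂ).re) (u, v)
      (isClosed_le (by fun_prop) (by fun_prop)) ?_
    rintro ⟨φ, ψ⟩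
    have := hT ι (fun _ => 1) φ ψ
    simpa [Pi.map, hA] using this
  obtain ⟨b, -⟩ := (exists_hilbertBasis ℂ H).choose_spec
  have hfin : ∀ s : Finset (exists_hilbertBasis ℂ H).choose,
      ∑ i ∈ s, ‖A (b i)‖ ^ 2 ≤ C ^ 2 := by
    intro s
    -- Testing on `∑ bᵢ ⊗ conj(A bᵢ)`: with `S = ∑ ‖A bᵢ‖²`, orthonormality turns the bound into `S²
    -- ≤ C² S`, hence `S ≤ C²`.
    have h1 := key s (fun i => b i) (fun i => A (b i))
    have h2 : ∑ i : s, ∑ l : s, ⟪b l, b i⟫_ℂ * ⟪A (b i), A (b l)⟫_ℂ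
        = ((∑ i ∈ s, ‖A (b i)‖ ^ 2 : ℝ) : ℂ) := by
      classical
      rw [← Finset.sum_coe_sort s]
      push_cast
      refine Finset.sum_congr rfl fun i _ => ?_
      rw [Finset.sum_eq_single i]
      · rw [inner_self_eq_norm_sq_to_K, inner_self_eq_norm_sq_to_K, b.orthonormal.1]
        simp
      · intro l _ hl
        rw [b.orthonormal.2 (fun h => hl (Subtype.ext h)), zero_mul]
      · simp
    have h3 : ∑ i : s, ⟪A (b i), A (b i)⟫_ℂ = ((∑ i ∈ s, ‖A (b i)‖ ^ 2 : ℝ) : ℂ) := by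
      rw [← Finset.sum_coe_sort s]
      push_cast
      exact Finset.sum_congr rfl fun i _ => inner_self_eq_norm_sq_to_K _
    rw [h2, h3, Complex.ofReal_re, Complex.norm_real, Real.norm_eq_abs, sq_abs] at h1
    by_contra! hlt
    nlinarith [sq_nonneg C]
  rw [schattenTwo_eq b]
  have h4 : ∑' i, ‖A (b i)‖ₑ ^ 2 ≤ ENNReal.ofReal (C ^ 2) := by
    rw [ENNReal.tsum_eq_iSup_sum]
    refine iSup_le fun s => ?_
    calc ∑ i ∈ s, ‖A (b i)‖ₑ ^ 2 = ENNReal.ofReal (∑ i ∈ s, ‖A (b i)‖ ^ 2) := by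
          rw [ENNReal.ofReal_sum_of_nonneg fun _ _ => by positivity]
          exact Finset.sum_congr rfl fun i _ => by
            rw [← ofReal_norm, ENNReal.ofReal_pow (norm_nonneg _)]
      _ ≤ _ := ENNReal.ofReal_le_ofReal (hfin s)
  calc (∑' i, ‖A (b i)‖ₑ ^ 2) ^ (1 / 2 : ℝ) ≤ (ENNReal.ofReal (C ^ 2)) ^ (1 / 2 : ℝ) := by gcongr
    _ = ENNReal.ofReal C := by
      rw [ENNReal.ofReal_rpow_of_nonneg (by positivity) (by norm_num), ← Real.sqrt_eq_rpow,
        Real.sqrt_sq hC]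

end HilbertSchmidtExtension

/-! ### Density of compactly supported functions in Schwartz space. -/

section SchwartzDensity

variable {E : Type*} [NormedAddCommGroup E] [InnerProductSpace ℝ E] [FiniteDimensional ℝ E]

/-- `χ - 1` vanishes on the unit ball, and outside it a constant bound is at most that constant
times `‖y‖`. The linear factor produces the small factor `a n` once the cutoff is rescaled. -/
theorem norm_iteratedFDeriv_bump_sub_one_le (χ : ContDiffBump (0 : E)) (hχ : χ.rIn = 1) (i : ℕ) :
    ∃ B : ℝ, 0 ≤ B ∧ ∀ y, ‖iteratedFDeriv ℝ i (fun x => χ x - 1) y‖ ≤ B * ‖y‖ := by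
  let χs : 𝓢(E, ℝ) := χ.hasCompactSupport.toSchwartzMap χ.contDiff
  refine ⟨SchwartzMap.seminorm ℝ 0 i χs + 1, by positivity, fun y => ?_⟩
  rcases lt_or_ge ‖y‖ 1 with hy | hy
  · have h0 : (fun x => χ x - 1) =ᶠ[nhds y] fun _ => (0 : ℝ) := by
      filter_upwards [Metric.isOpen_ball.mem_nhds (by simpa using hy : y ∈ Metric.ball (0 : E) 1)]
        with x hx
      rw [χ.one_of_mem_closedBall (by rw [hχ]; exact Metric.ball_subset_closedBall hx), sub_self]
    rw [h0.iteratedFDeriv ℝ i |>.eq_of_nhds]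
    simp only [iteratedFDeriv_fun_zero, Pi.zero_apply, norm_zero]
    positivity
  · have h1 : iteratedFDeriv ℝ i (fun x => χ x - 1) y
        = iteratedFDeriv ℝ i χ y - iteratedFDeriv ℝ i (fun _ : E => (1 : ℝ)) y :=
      fun_iteratedFDeriv_sub_apply χ.contDiff.contDiffAt contDiff_const.contDiffAt
    have h2 : ‖iteratedFDeriv ℝ i (fun _ : E => (1 : ℝ)) y‖ ≤ 1 := by
      rcases Nat.eq_zero_or_pos i with rfl | hi
      · simp
      · rw [iteratedFDeriv_const_of_ne (by omega)]; simp
    have h3 : ‖iteratedFDeriv ℝ i χ y‖ ≤ SchwartzMap.seminorm ℝ 0 i χs :=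
      χs.norm_iteratedFDeriv_le_seminorm ℝ i y
    have h4 : 0 ≤ SchwartzMap.seminorm ℝ 0 i χs := apply_nonneg _ _
    calc _ ≤ SchwartzMap.seminorm ℝ 0 i χs + 1 := by
          rw [h1]; exact (norm_sub_le _ _).trans (add_le_add h3 h2)
      _ ≤ _ := le_mul_of_one_le_right (by positivity) hy

/-- Compactly supported functions are dense in the Schwartz space. -/
theorem dense_hasCompactSupport_schwartz : Dense {s : 𝓢(E, ℂ) | HasCompactSupport s} := by
  intro s
  let χ : ContDiffBump (0 : E) := ⟨1, 2, one_pos, by norm_num⟩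
  let a : ℕ → ℝ := fun n => ((n : ℝ) + 1)⁻¹
  have ha : ∀ n, 0 < a n := fun n => by positivity
  have ha1 : ∀ n, a n ≤ 1 := fun n => inv_le_one_of_one_le₀ (by linarith [n.cast_nonneg (α := ℝ)])
  have hsm : ∀ n, ContDiff ℝ ∞ fun x => χ (a n • x) := fun n =>
    χ.contDiff.comp (contDiff_const_smul _)
  have hcs : ∀ n, HasCompactSupport fun x => χ (a n • x) := fun n =>
    χ.hasCompactSupport.comp_homeomorph (Homeomorph.smulOfNeZero (a n) (ha n).ne')
  have hcs' : ∀ n, HasCompactSupport fun x => χ (a n • x) • s x := fun n => (hcs n).smul_right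
  let t : ℕ → 𝓢(E, ℂ) := fun n => (hcs' n).toSchwartzMap ((hsm n).smul (s.smooth ⊤))
  refine mem_closure_of_tendsto (f := t) (b := Filter.atTop) ?_
    (Filter.Eventually.of_forall fun n => hcs' n)
  refine ((schwartz_withSeminorms ℝ E ℂ).tendsto_nhds _ _).2 ?_
  rintro ⟨k, m⟩ ε hε
  choose B hB0 hB using fun i => norm_iteratedFDeriv_bump_sub_one_le χ rfl i
  set C := ∑ i ∈ Finset.range (m + 1), (m.choose i : ℝ) * B i *
    SchwartzMap.seminorm ℝ (k + 1) (m - i) s with hC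
  have hC0 : 0 ≤ C := Finset.sum_nonneg fun i _ => by have := hB0 i; positivity
  -- Every Leibniz term gains `a n * ‖x‖`; the extra `‖x‖` is absorbed by the seminorm of `s` with
  -- weight `k + 1`.
  have hbound : ∀ n, SchwartzMap.seminorm ℝ k m (t n - s) ≤ a n * C := by
    intro n
    refine SchwartzMap.seminorm_le_bound ℝ k m _ (mul_nonneg (ha n).le hC0) fun x => ?_
    have h1 : ((t n - s : 𝓢(E, ℂ)) : E → ℂ) = fun x => (χ (a n • x) - 1) • s x := by
      funext x
      rw [sub_apply, sub_smul, one_smul]; rfl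
    have hsm1 : ContDiff ℝ ∞ fun x => χ (a n • x) - 1 := (hsm n).sub contDiff_const
    have h2 : ∀ i, ‖iteratedFDeriv ℝ i (fun x => χ (a n • x) - 1) x‖ ≤ a n * B i * ‖x‖ := by
      intro i
      have h3 := congrFun (iteratedFDeriv_comp_const_smul (𝕜 := ℝ) (i := i)
        (f := fun x : E => χ x - 1) (a n) (χ.contDiff.sub contDiff_const)) x
      rw [h3, norm_smul, norm_pow, Real.norm_eq_abs, abs_of_pos (ha n)]
      have h4 := hB i (a n • x)
      rw [norm_smul, Real.norm_eq_abs, abs_of_pos (ha n)] at h4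
      calc _ ≤ 1 * (B i * (a n * ‖x‖)) := by
            gcongr
            · exact pow_le_one₀ (ha n).le (ha1 n)
        _ = _ := by ring
    rw [h1]
    have h5 := norm_iteratedFDeriv_smul_le (𝕜 := ℝ) hsm1 (s.smooth ⊤) x (n := m)
      (by exact_mod_cast le_top)
    calc _ ≤ ‖x‖ ^ k * ∑ i ∈ Finset.range (m + 1), (m.choose i : ℝ) *
          ‖iteratedFDeriv ℝ i (fun x => χ (a n • x) - 1) x‖ * ‖iteratedFDeriv ℝ (m - i) s x‖ := by
          gcongr
      _ ≤ ‖x‖ ^ k * ∑ i ∈ Finset.range (m + 1), (m.choose i : ℝ) *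
          (a n * B i * ‖x‖) * ‖iteratedFDeriv ℝ (m - i) s x‖ := by
          gcongr with i _
          exact h2 i
      _ = a n * ∑ i ∈ Finset.range (m + 1), (m.choose i : ℝ) * B i *
          (‖x‖ ^ (k + 1) * ‖iteratedFDeriv ℝ (m - i) s x‖) := by
          rw [Finset.mul_sum, Finset.mul_sum]
          exact Finset.sum_congr rfl fun i _ => by ring
      _ ≤ a n * C := by
          refine mul_le_mul_of_nonneg_left (Finset.sum_le_sum fun i _ => ?_) (ha n).le
          exact mul_le_mul_of_nonneg_left (s.le_seminorm ℝ _ _ x)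
            (mul_nonneg (by positivity) (hB0 i))
  have hlim : Filter.Tendsto (fun n => a n * C) Filter.atTop (nhds 0) := by
    have : Filter.Tendsto a Filter.atTop (nhds 0) := by
      simpa [a] using tendsto_one_div_add_atTop_nhds_zero_nat (𝕜 := ℝ)
    simpa using this.mul_const C
  filter_upwards [hlim.eventually (gt_mem_nhds hε)] with n hn
  exact (hbound n).trans_lt hn

end SchwartzDensity

/-! ### Elementary inequalities for the Japanese bracket. -/

section BracketInequalities

theorem one_le_bracket (v : X) : 1 ≤ bracket v := by
  rw [bracket, Real.one_le_sqrt]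
  linarith [sq_nonneg ‖v‖]

theorem bracket_sq (v : X) : bracket v ^ 2 = 1 + ‖v‖ ^ 2 :=
  Real.sq_sqrt (by positivity)

theorem bracket_sub_le (v w : X) : bracket v - bracket w ≤ ‖v - w‖ := by
  have hv := one_le_bracket v
  have hw := one_le_bracket w
  have h1 : (bracket v - bracket w) * (bracket v + bracket w) = ‖v‖ ^ 2 - ‖w‖ ^ 2 := by
    have := bracket_sq v
    have := bracket_sq w
    linarith
  have hv' : ‖v‖ ≤ bracket v := Real.le_sqrt_of_sq_le (by linarith)
  have hw' : ‖w‖ ≤ bracket w := Real.le_sqrt_of_sq_le (by linarith)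
  have h2 : ‖v‖ - ‖w‖ ≤ ‖v - w‖ := norm_sub_norm_le v w
  have h3 := norm_nonneg (v - w)
  by_contra! h
  nlinarith [norm_nonneg v, norm_nonneg w,
    mul_le_mul_of_nonneg_right h2 (add_nonneg (norm_nonneg v) (norm_nonneg w)),
    mul_le_mul_of_nonneg_left (add_le_add hv' hw') h3]

/-- The bracket is `1`-Lipschitz. -/
theorem abs_bracket_sub_le (v w : X) : |bracket v - bracket w| ≤ ‖v - w‖ :=
  abs_sub_le_iff.2 ⟨bracket_sub_le v w, by rw [norm_sub_rev]; exact bracket_sub_le w v⟩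

theorem norm_add_sq_add_norm_sub_sq (v w : X) :
    ‖v + w‖ ^ 2 + ‖v - w‖ ^ 2 = 2 * (‖v‖ ^ 2 + ‖w‖ ^ 2) := by
  have := parallelogram_law_with_norm ℝ v w
  nlinarith

/-- The upper bound is `2ab ≤ a² + b²` followed by the parallelogram law. The lower bound uses `(1 +
a²)(1 + b²) ≥ (1 + ab)²` with `a = ‖v + w‖`, `b = ‖v - w‖`, and `ab ≥ ⟪v + w, v - w⟫ = ‖v‖² - ‖w‖²`.
-/
theorem abs_bracket_mul_sub_le (v w : X) :
    |bracket (v + w) * bracket (v - w) - bracket v ^ 2| ≤ ‖w‖ ^ 2 := by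
  have hp := one_le_bracket (v + w)
  have hm := one_le_bracket (v - w)
  have hps := bracket_sq (v + w)
  have hms := bracket_sq (v - w)
  have hv := bracket_sq v
  have hpar := norm_add_sq_add_norm_sub_sq v w
  rw [abs_sub_le_iff]
  constructor
  · nlinarith [sq_nonneg (bracket (v + w) - bracket (v - w))]
  · have h1 : 1 + (‖v‖ ^ 2 - ‖w‖ ^ 2) ≤ bracket (v + w) * bracket (v - w) := by
      have h2 : ‖v‖ ^ 2 - ‖w‖ ^ 2 = ⟪v + w, v - w⟫_ℝ := by
        rw [inner_add_left, inner_sub_right, inner_sub_right, real_inner_self_eq_norm_sq,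
          real_inner_self_eq_norm_sq, real_inner_comm v w]
        ring
      have h3 := real_inner_le_norm (v + w) (v - w)
      refine (le_trans (add_le_add_right (h2.le.trans h3) 1)) ?_
      rw [bracket, bracket, ← Real.sqrt_mul (by positivity)]
      refine Real.le_sqrt_of_sq_le ?_
      nlinarith [sq_nonneg (‖v + w‖ - ‖v - w‖)]
    linarith

/-- Expanding the squared product leaves at least `1 + ‖v + w‖² + ‖v - w‖² = 1 + 2‖v‖² + 2‖w‖²`.
This lets a weight in `ξ` be traded for weights on `φ` and `ψ`. -/
theorem bracket_le_mul (v w : X) : bracket v ≤ bracket (v + w) * bracket (v - w) := by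
  have hp := one_le_bracket (v + w)
  have hm := one_le_bracket (v - w)
  have hps := bracket_sq (v + w)
  have hms := bracket_sq (v - w)
  have hv := bracket_sq v
  have hpar := norm_add_sq_add_norm_sub_sq v w
  have h0 := one_le_bracket v
  refine (sq_le_sq₀ (by linarith) (by positivity)).1 ?_
  rw [mul_pow]
  nlinarith [mul_nonneg (sq_nonneg ‖v + w‖) (sq_nonneg ‖v - w‖), sq_nonneg ‖w‖,
    sq_nonneg ‖v + w‖, sq_nonneg ‖v - w‖]

end BracketInequalities

/-! ### Parseval, Plancherel and Fourier multipliers in `L²`. -/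

section FourierMultiplier

theorem eLpNorm_two_sq {α ε : Type*} [MeasurableSpace α] [NormedAddCommGroup ε] (μ : Measure α)
    (f : α → ε) : eLpNorm f 2 μ ^ 2 = ∫⁻ x, ‖f x‖ₑ ^ 2 ∂μ := by
  have := eLpNorm_nnreal_pow_eq_lintegral (f := f) (μ := μ) (p := 2) (by norm_num)
  simpa using this

theorem lintegral_mul_sq_le {α : Type*} [MeasurableSpace α] (μ : Measure α) {f g : α → ℝ≥0∞}
    (hf : AEMeasurable f μ) (hg : AEMeasurable g μ) :
    (∫⁻ x, f x * g x ∂μ) ^ 2 ≤ (∫⁻ x, f x ^ 2 ∂μ) * ∫⁻ x, g x ^ 2 ∂μ := by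
  have h := ENNReal.lintegral_mul_le_Lp_mul_Lq μ Real.HolderConjugate.two_two hf hg
  have h2 : ∀ a : ℝ≥0∞, (a ^ (1 / 2 : ℝ)) ^ 2 = a := fun a => by
    rw [← ENNReal.rpow_natCast, ← ENNReal.rpow_mul]; norm_num
  calc _ ≤ ((∫⁻ x, f x ^ (2 : ℝ) ∂μ) ^ (1 / 2 : ℝ) * (∫⁻ x, g x ^ (2 : ℝ) ∂μ) ^ (1 / 2 : ℝ)) ^ 2 := by
        gcongr; exact h
    _ = _ := by rw [mul_pow, h2, h2]; norm_cast

/-- Parseval's formula between `L²` and Schwartz functions. -/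
theorem integral_mul_fourierInv {u : X → ℂ} (hu : MemLp u 2 volume) (s : 𝓢(X, ℂ)) :
    ∫ x, u x * (𝓕⁻ s) x = ∫ η, (𝓕⁻ (hu.toLp u) : L2X) η * s η := by
  have h := congrArg (fun T => T s) (Lp.fourierInv_toTemperedDistribution_eq (hu.toLp u))
  simp only [TemperedDistribution.fourierInv_apply, Lp.toTemperedDistribution_apply] at h
  calc _ = ∫ x, (𝓕⁻ s) x • (hu.toLp u) x := by
        refine integral_congr_ae ?_
        filter_upwards [hu.coeFn_toLp] with x hx
        rw [hx, smul_eq_mul, mul_comm]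
    _ = _ := by
        rw [h]
        exact integral_congr_ae (Filter.Eventually.of_forall fun x => by
          simp only [smul_eq_mul, mul_comm])

theorem lintegral_fourierInv_sq {u : X → ℂ} (hu : MemLp u 2 volume) :
    ∫⁻ η, ‖(𝓕⁻ (hu.toLp u) : L2X) η‖ₑ ^ 2 = ∫⁻ x, ‖u x‖ₑ ^ 2 := by
  have h : ‖(𝓕⁻ (hu.toLp u) : L2X)‖ = ‖hu.toLp u‖ :=
    (Lp.fourierTransformₗᵢ X ℂ).symm.norm_map (hu.toLp u)
  have h' : ‖(𝓕⁻ (hu.toLp u) : L2X)‖ₑ = ‖hu.toLp u‖ₑ := by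
    rw [← ofReal_norm, h, ofReal_norm]
  rw [Lp.enorm_def, Lp.enorm_def, eLpNorm_congr_ae hu.coeFn_toLp] at h'
  rw [← eLpNorm_two_sq, ← eLpNorm_two_sq, h']

theorem lintegral_schwartz_fourierInv_sq (s : 𝓢(X, ℂ)) :
    ∫⁻ x, ‖(𝓕⁻ s) x‖ₑ ^ 2 = ∫⁻ η, ‖s η‖ₑ ^ 2 := by
  have h := lintegral_fourierInv_sq (s.memLp 2)
  rw [← h]
  refine lintegral_congr_ae ?_
  have h1 : (𝓕⁻ ((s.memLp 2).toLp s) : L2X) = (𝓕⁻ s).toLp 2 := SchwartzMap.toLp_fourierInv_eq s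
  rw [h1]
  filter_upwards [(𝓕⁻ s).coeFn_toLp 2] with x hx
  rw [hx]

/-- If `u` and `g` are related by a Fourier multiplier in the sense of distributions, so are their
inverse Fourier transforms. -/
theorem fourierInv_multiplier_ae {u g : X → ℂ} (hu : MemLp u 2 volume) (hg : MemLp g 2 volume)
    {q : X → ℂ} (hq : q.HasTemperateGrowth)
    (h : ∀ s : 𝓢(X, ℂ), ∫ x, (𝓕⁻ (SchwartzMap.smulLeftCLM ℂ q s)) x * u x
      = ∫ x, (𝓕⁻ s) x * g x) :
    ∀ᵐ η, q η * (𝓕⁻ (hu.toLp u) : L2X) η = (𝓕⁻ (hg.toLp g) : L2X) η := by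
  set U : L2X := 𝓕⁻ (hu.toLp u)
  set G : L2X := 𝓕⁻ (hg.toLp g)
  have hU : LocallyIntegrable U volume := (Lp.memLp U).locallyIntegrable (by norm_num)
  have hG : LocallyIntegrable G volume := (Lp.memLp G).locallyIntegrable (by norm_num)
  have hqU : LocallyIntegrable (fun η => q η * U η) volume :=
    (hU.continuous_smul hq.1.continuous : _)
  -- Taking `s = χ` smooth with compact support, Parseval turns the hypothesis into `∫ (q U - G) χ =
  -- 0`.
  have h0 : ∀ᵐ η, q η * U η - G η = 0 := by
    refine ae_eq_zero_of_integral_contDiff_smul_eq_zero (hqU.sub hG) fun χ hχ hχc => ?_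
    have hχ1 : HasCompactSupport (Complex.ofRealCLM ∘ χ) := hχc.comp_left rfl
    have hχ2 : ContDiff ℝ ∞ (Complex.ofRealCLM ∘ χ) := by fun_prop
    let s : 𝓢(X, ℂ) := hχ1.toSchwartzMap hχ2
    have hs : ∀ η, s η = (χ η : ℂ) := fun η => rfl
    have h1 := h s
    simp_rw [mul_comm _ (u _), mul_comm _ (g _)] at h1
    rw [integral_mul_fourierInv hu, integral_mul_fourierInv hg] at h1
    simp_rw [SchwartzMap.smulLeftCLM_apply_apply hq, hs] at h1
    have i1 : Integrable (fun η => U η * (q η • (χ η : ℂ))) volume := by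
      have := (Lp.memLp U).integrable_mul ((SchwartzMap.smulLeftCLM ℂ q s).memLp 2)
      refine this.congr (Filter.Eventually.of_forall fun η => ?_)
      simp only [Pi.mul_apply, SchwartzMap.smulLeftCLM_apply_apply hq, hs]
    have i2 : Integrable (fun η => G η * (χ η : ℂ)) volume := by
      have := (Lp.memLp G).integrable_mul (s.memLp 2 volume)
      exact this.congr (Filter.Eventually.of_forall fun η => rfl)
    rw [← sub_eq_zero, ← integral_sub i1 i2] at h1
    rw [← h1]
    refine integral_congr_ae (Filter.Eventually.of_forall fun η => ?_)
    simp only [Complex.real_smul, smul_eq_mul]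
    ring
  filter_upwards [h0] with η hη using sub_eq_zero.1 hη

/-- A pairing with a Schwartz function is controlled by a weighted norm of the Fourier transform. -/
theorem enorm_integral_fourierInv_sq_le {u : X → ℂ} (hu : MemLp u 2 volume) {w : X → ℝ≥0∞}
    (hw : Measurable w) {κ : 𝓢(X, ℂ)} {K : X → ℂ} (hK : AEStronglyMeasurable K volume)
    {C : ℝ≥0∞} (hκ : ∀ η, ‖κ η‖ₑ ≤ C * (w η * ‖K η‖ₑ)) :
    ‖∫ x, u x * (𝓕⁻ κ) x‖ₑ ^ 2 ≤
      C ^ 2 * ((∫⁻ η, (w η * ‖(𝓕⁻ (hu.toLp u) : L2X) η‖ₑ) ^ 2) * ∫⁻ η, ‖K η‖ₑ ^ 2) := by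
  rw [integral_mul_fourierInv hu]
  set U : L2X := 𝓕⁻ (hu.toLp u)
  have hm : AEMeasurable (fun η => w η * ‖U η‖ₑ) volume :=
    hw.aemeasurable.mul (Lp.aestronglyMeasurable U).enorm
  calc _ ≤ (∫⁻ η, C * ((w η * ‖U η‖ₑ) * ‖K η‖ₑ)) ^ 2 := by
        gcongr
        refine (enorm_integral_le_lintegral_enorm _).trans (lintegral_mono fun η => ?_)
        rw [enorm_mul]
        calc _ ≤ ‖U η‖ₑ * (C * (w η * ‖K η‖ₑ)) := by gcongr; exact hκ η
          _ = _ := by ring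
    _ = C ^ 2 * (∫⁻ η, (w η * ‖U η‖ₑ) * ‖K η‖ₑ) ^ 2 := by
        have hm2 : AEMeasurable (fun η => w η * ‖U η‖ₑ * ‖K η‖ₑ) volume := hm.mul hK.enorm
        rw [lintegral_const_mul'' _ hm2, mul_pow]
    _ ≤ _ := by
        gcongr
        exact lintegral_mul_sq_le _ hm hK.enorm

end FourierMultiplier

/-! ### Restriction of phase space identities to fibers of fixed momentum. -/

section Fibers

theorem memLp_tensor {a b : X → ℂ} (ha : MemLp a 2 volume) (hb : MemLp b 2 volume) :
    MemLp (fun z : Phase => a z.1 * b z.2) 2 volume := by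
  have hm : AEStronglyMeasurable (fun z : Phase => a z.1 * b z.2) volume :=
    (ha.1.comp_fst).mul (hb.1.comp_snd)
  rw [memLp_two_iff_integrable_sq_norm hm]
  have h1 := (memLp_two_iff_integrable_sq_norm ha.1).1 ha
  have h2 := (memLp_two_iff_integrable_sq_norm hb.1).1 hb
  refine (h1.mul_prod h2).congr (Filter.Eventually.of_forall fun z => ?_)
  simp only [norm_mul, mul_pow]

theorem integrable_tensor_mul {a b : X → ℂ} (ha : MemLp a 2 volume) (hb : MemLp b 2 volume)
    {f : Phase → ℂ} (hf : MemLp f 2 volume) :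
    Integrable (fun z : Phase => b z.2 * (a z.1 * f z)) volume := by
  refine ((memLp_tensor ha hb).integrable_mul hf).congr (Filter.Eventually.of_forall fun z => ?_)
  simp only [Pi.mul_apply]
  ring

theorem ae_memLp_fiber {ε : Type*} [NormedAddCommGroup ε] {f : Phase → ε}
    (hf : MemLp f 2 volume) : ∀ᵐ ξ : X, MemLp (fun x : X => f (x, ξ)) 2 volume := by
  have hm : AEStronglyMeasurable f ((volume : Measure X).prod (volume : Measure X)) := hf.1
  have h1 : ∫⁻ ξ : X, ∫⁻ x : X, ‖f (x, ξ)‖ₑ ^ 2 ≠ ⊤ := by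
    rw [← lintegral_prod_symm (fun z : Phase => ‖f z‖ₑ ^ 2) (hm.enorm.pow_const 2)]
    rw [← Measure.volume_eq_prod, ← eLpNorm_two_sq]
    exact ENNReal.pow_ne_top hf.2.ne
  have h2 : ∀ᵐ ξ : X, ∫⁻ x : X, ‖f (x, ξ)‖ₑ ^ 2 < ⊤ := by
    refine ae_lt_top' ?_ h1
    exact (hm.enorm.pow_const 2).lintegral_prod_left'
  filter_upwards [h2, hm.prodMk_right] with ξ h3 h4
  refine ⟨h4, ?_⟩
  rw [← eLpNorm_two_sq] at h3
  refine lt_top_iff_ne_top.2 fun h => ?_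
  simp [h] at h3

theorem locallyIntegrable_integral_fiber {a : X → ℂ} (ha : MemLp a 2 volume)
    {f : Phase → ℂ} (hf : MemLp f 2 volume) :
    LocallyIntegrable (fun ξ : X => ∫ x : X, a x * f (x, ξ)) volume := by
  rw [locallyIntegrable_iff]
  intro k hk
  -- The compact cutoff in `ξ` supplies the second square integrable factor needed to pair with `f`
  -- on phase space.
  have hb : MemLp (k.indicator fun _ => (1 : ℂ)) 2 (volume : Measure X) :=
    memLp_indicator_const 2 hk.measurableSet 1 (Or.inr hk.measure_lt_top.ne)
  have h1 := (integrable_tensor_mul ha hb hf).integral_prod_right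
  rw [← integrable_indicator_iff hk.measurableSet]
  refine h1.congr (Filter.Eventually.of_forall fun ξ => ?_)
  by_cases h : ξ ∈ k <;> simp [h]

/-- Continuity of this pairing in the `L²` class of `s` makes the fiber identity a closed condition,
so that a countable dense family of test functions suffices. -/
theorem exists_clm_integral_mul {u : X → ℂ} (hu : MemLp u 2 volume) :
    ∃ ℓ : L2X →L[ℂ] ℂ, ∀ s : 𝓢(X, ℂ), ℓ (s.toLp 2) = ∫ x, s x * u x := by
  have hu' : MemLp (fun x => conj (u x)) 2 volume := hu.star
  refine ⟨innerSL ℂ (hu'.toLp _), fun s => ?_⟩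
  rw [innerSL_apply_apply, L2.inner_def]
  refine integral_congr_ae ?_
  filter_upwards [hu'.coeFn_toLp, s.coeFn_toLp 2] with x h1 h2
  rw [h1, h2, RCLike.inner_apply, Complex.conj_conj]

/-- An identity between distributions on phase space that only involves operations in the variable
`x` holds on almost every fiber, against all Schwartz functions. -/
theorem ae_fiber_identity {f g : Phase → ℂ} (hf : MemLp f 2 volume) (hg : MemLp g 2 volume)
    (P : 𝓢(X, ℂ) →L[ℂ] 𝓢(X, ℂ))
    (H : ∀ s : 𝓢(X, ℂ), HasCompactSupport s → ∀ b : X → ℝ, ContDiff ℝ ∞ b → HasCompactSupport b →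
      ∫ z : Phase, (b z.2 : ℂ) * (P s z.1 * f z) = ∫ z : Phase, (b z.2 : ℂ) * (s z.1 * g z)) :
    ∀ᵐ ξ : X, ∀ s : 𝓢(X, ℂ), ∫ x, P s x * f (x, ξ) = ∫ x, s x * g (x, ξ) := by
  -- Here the exceptional null set still depends on `s`; separability removes this dependence below.
  have h1 : ∀ s : 𝓢(X, ℂ), HasCompactSupport s →
      ∀ᵐ ξ : X, ∫ x, P s x * f (x, ξ) = ∫ x, s x * g (x, ξ) := by
    intro s hs
    have hl1 := locallyIntegrable_integral_fiber ((P s).memLp 2) hf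
    have hl2 := locallyIntegrable_integral_fiber (s.memLp 2) hg
    have h2 := ae_eq_of_integral_contDiff_smul_eq hl1 hl2 fun b hb hbc => by
      have hb2 : MemLp (fun ξ => (b ξ : ℂ)) 2 (volume : Measure X) :=
        (hb.continuous.memLp_of_hasCompactSupport hbc).ofReal
      have e1 := integral_prod_symm _ (integrable_tensor_mul ((P s).memLp 2) hb2 hf)
      have e2 := integral_prod_symm _ (integrable_tensor_mul (s.memLp 2) hb2 hg)
      simp only [integral_const_mul] at e1 e2
      simp only [Complex.real_smul]
      rw [← e1, ← e2]
      exact H s hs b hb hbc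
    exact h2
  -- `P` need not be continuous for the `L²` norm, so the density argument takes place in the graph
  -- of `P`, which is separable as a subset of `L² × L²`.
  let Φ : 𝓢(X, ℂ) → L2X × L2X := fun s => ((P s).toLp 2, s.toLp 2)
  have hΦ : Continuous Φ :=
    (SchwartzMap.continuous_toLp.comp P.continuous).prodMk SchwartzMap.continuous_toLp
  let D : Set 𝓢(X, ℂ) := {s | HasCompactSupport s}
  have : Fact ((2 : ℝ≥0∞) ≠ ⊤) := ⟨by norm_num⟩
  have : SecondCountableTopology L2X := Lp.SecondCountableTopology
  obtain ⟨t, hts, htc, hdense⟩ :=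
    (TopologicalSpace.IsSeparable.of_separableSpace (Φ '' D)).exists_countable_dense_subset
  have hts' : ∀ p ∈ t, ∃ s, s ∈ D ∧ Φ s = p := fun p hp => hts hp
  choose! σ hσ using hts'
  have h3 : ∀ᵐ ξ : X, ∀ p ∈ t, ∫ x, P (σ p) x * f (x, ξ) = ∫ x, σ p x * g (x, ξ) :=
    (ae_ball_iff htc).2 fun p hp => h1 (σ p) (hσ p hp).1
  filter_upwards [h3, ae_memLp_fiber hf, ae_memLp_fiber hg] with ξ h4 hfξ hgξ s
  obtain ⟨ℓ, hℓ⟩ := exists_clm_integral_mul hfξ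
  obtain ⟨ℓ', hℓ'⟩ := exists_clm_integral_mul hgξ
  have hclosed : IsClosed {p : L2X × L2X | ℓ p.1 = ℓ' p.2} :=
    isClosed_eq (by fun_prop) (by fun_prop)
  have h5 : Φ '' D ⊆ {p : L2X × L2X | ℓ p.1 = ℓ' p.2} := by
    refine hdense.trans (hclosed.closure_subset_iff.2 fun p hp => ?_)
    have h6 := h4 p hp
    rw [← hℓ, ← hℓ'] at h6
    rw [← (hσ p hp).2]
    exact h6
  have h7 : s ∈ Φ ⁻¹' {p : L2X × L2X | ℓ p.1 = ℓ' p.2} :=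
    (hclosed.preimage hΦ).closure_subset_iff.2 (fun r hr => h5 ⟨r, hr, rfl⟩)
      (dense_hasCompactSupport_schwartz s)
  rw [← hℓ, ← hℓ']
  exact h7

end Fibers

/-! ### Weak derivatives in `x` on almost every fiber. -/

section WeakDerivatives

theorem isTest_tensor {a b : X → ℝ} (ha : ContDiff ℝ ∞ a) (hac : HasCompactSupport a)
    (hb : ContDiff ℝ ∞ b) (hbc : HasCompactSupport b) :
    IsTest (fun z : Phase => a z.1 * b z.2) := by
  refine ⟨by fun_prop, HasCompactSupport.intro (hac.isCompact.prod hbc.isCompact) fun z hz => ?_⟩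
  rw [Set.mem_prod, not_and_or] at hz
  rcases hz with h | h
  · rw [image_eq_zero_of_notMem_tsupport h, zero_mul]
  · rw [image_eq_zero_of_notMem_tsupport h, mul_zero]

theorem fderiv_tensor {a b : X → ℝ} (ha : Differentiable ℝ a) (hb : Differentiable ℝ b)
    (z : Phase) (v : X) :
    fderiv ℝ (fun z : Phase => a z.1 * b z.2) z (v, 0) = fderiv ℝ a z.1 v * b z.2 := by
  have h1 : HasFDerivAt (fun z : Phase => a z.1) _ z :=
    (ha z.1).hasFDerivAt.comp z hasFDerivAt_fst
  have h2 : HasFDerivAt (fun z : Phase => b z.2) _ z :=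
    (hb z.2).hasFDerivAt.comp z hasFDerivAt_snd
  rw [(h1.fun_mul h2).fderiv]
  simp [mul_comm]

theorem apply_lineDerivOp (L : ℂ →L[ℝ] ℝ) (s : 𝓢(X, ℂ)) (v : X) :
    (fun x => L (LineDeriv.lineDerivOp v s x)) = fun x => fderiv ℝ (fun y => L (s y)) x v := by
  funext x
  rw [SchwartzMap.lineDerivOp_apply_eq_fderiv]
  have h : HasFDerivAt (fun y => L (s y)) _ x :=
    L.hasFDerivAt.comp x (s.hasFDerivAt x)
  rw [h.fderiv]; rfl

theorem contDiff_clm_schwartz (L : ℂ →L[ℝ] ℝ) (s : 𝓢(X, ℂ)) : ContDiff ℝ ∞ fun x => L (s x) :=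
  L.contDiff.comp (s.smooth ⊤)

/-- Weak derivatives are tested on real functions, whereas Schwartz functions are complex. Taking
`L` to be the real and the imaginary part bridges the two. -/
theorem tensor_identity_of_real {f g : Phase → ℂ} (hf : MemLp f 2 volume) (hg : MemLp g 2 volume)
    {r s : 𝓢(X, ℂ)} {b : X → ℝ} (hb : ContDiff ℝ ∞ b) (hbc : HasCompactSupport b)
    (h : ∀ L : ℂ →L[ℝ] ℝ, ∫ z : Phase, ((L (r z.1) * b z.2 : ℝ) : ℂ) * f z
      = ∫ z : Phase, ((L (s z.1) * b z.2 : ℝ) : ℂ) * g z) :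
    ∫ z : Phase, (b z.2 : ℂ) * (r z.1 * f z) = ∫ z : Phase, (b z.2 : ℂ) * (s z.1 * g z) := by
  have hb2 : MemLp (fun ξ => (b ξ : ℂ)) 2 (volume : Measure X) :=
    (hb.continuous.memLp_of_hasCompactSupport hbc).ofReal
  have split : ∀ (r : 𝓢(X, ℂ)) {f : Phase → ℂ}, MemLp f 2 volume →
      ∫ z : Phase, (b z.2 : ℂ) * (r z.1 * f z) =
        (∫ z : Phase, ((Complex.reCLM (r z.1) * b z.2 : ℝ) : ℂ) * f z) +
        Complex.I * ∫ z : Phase, ((Complex.imCLM (r z.1) * b z.2 : ℝ) : ℂ) * f z := by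
    intro r f hf
    have hi : ∀ L : ℂ →L[ℝ] ℝ,
        Integrable (fun z : Phase => ((L (r z.1) * b z.2 : ℝ) : ℂ) * f z) volume := by
      intro L
      have hL : MemLp (fun x => ((L (r x) : ℝ) : ℂ)) 2 (volume : Measure X) :=
        (L.comp_memLp' (r.memLp 2)).ofReal
      refine (integrable_tensor_mul hL hb2 hf).congr (Filter.Eventually.of_forall fun z => ?_)
      push_cast; ring
    rw [← integral_const_mul, ← integral_add (hi _) ((hi _).const_mul _)]
    refine integral_congr_ae (Filter.Eventually.of_forall fun z => ?_)
    have := Complex.re_add_im (r z.1)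
    simp only [Complex.reCLM_apply, Complex.imCLM_apply]
    push_cast
    linear_combination (-(b z.2 : ℂ) * f z) * this
  rw [split r hf, split s hg, h, h]

/-- Product test functions `a(x) b(ξ)` separate the variables. The sign from integration by parts is
put into the operator, to fit the form of `ae_fiber_identity`. -/
theorem IsWeakDeriv.ae_fiber {f g : Phase → ℂ} {i : Fin 3} (h : IsWeakDeriv (dirX i) f g)
    (hf : MemLp f 2 volume) (hg : MemLp g 2 volume) :
    ∀ᵐ ξ : X, ∀ s : 𝓢(X, ℂ),
      ∫ x, (-LineDeriv.lineDerivOp (EuclideanSpace.single i (1 : ℝ) : X) s) x * f (x, ξ)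
        = ∫ x, s x * g (x, ξ) := by
  refine ae_fiber_identity hf hg
    (-(LineDeriv.lineDerivOpCLM ℂ 𝓢(X, ℂ) (EuclideanSpace.single i (1 : ℝ) : X))) ?_
  intro s hs b hb hbc
  refine tensor_identity_of_real hf hg hb hbc fun L => ?_
  have ha := contDiff_clm_schwartz L s
  have h1 := h.2.2 _ (isTest_tensor ha (hs.comp_left (map_zero L)) hb hbc)
  have h2 := congrFun (apply_lineDerivOp L s (EuclideanSpace.single i 1))
  simp_rw [dirX, fderiv_tensor (ha.differentiable (by simp)) (hb.differentiable (by simp)),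
    ← h2] at h1
  rw [← neg_eq_iff_eq_neg, ← integral_neg] at h1
  rw [← h1]
  refine integral_congr_ae (Filter.Eventually.of_forall fun z => ?_)
  simp [neg_apply]

theorem IsWeakLaplacianX.ae_fiber {f g : Phase → ℂ} (h : IsWeakLaplacianX f g)
    (hf : MemLp f 2 volume) (hg : MemLp g 2 volume) :
    ∀ᵐ ξ : X, ∀ s : 𝓢(X, ℂ),
      ∫ x, (Laplacian.laplacian s) x * f (x, ξ) = ∫ x, s x * g (x, ξ) := by
  have hP : ∀ s : 𝓢(X, ℂ), LineDeriv.laplacianCLM ℂ X 𝓢(X, ℂ) s = Laplacian.laplacian s :=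
    fun s => SchwartzMap.laplacianCLM_eq ℂ s
  simp_rw [← hP]
  refine ae_fiber_identity hf hg (LineDeriv.laplacianCLM ℂ X 𝓢(X, ℂ)) ?_
  intro s hs b hb hbc
  refine tensor_identity_of_real hf hg hb hbc fun L => ?_
  have ha := contDiff_clm_schwartz L s
  have h1 := h.2.2 _ (isTest_tensor ha (hs.comp_left (map_zero L)) hb hbc)
  rw [← h1]
  refine integral_congr_ae (Filter.Eventually.of_forall fun z => ?_)
  have hd : ∀ r : 𝓢(X, ℂ), Differentiable ℝ fun x => L (r x) := fun r =>
    (contDiff_clm_schwartz L r).differentiable (by simp)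
  have hbd : Differentiable ℝ b := hb.differentiable (by simp)
  simp only [dirX, fderiv_tensor (hd s) hbd]
  have h3 : ∀ v : X, ∀ w : Phase, fderiv ℝ (fun w : Phase => fderiv ℝ (fun y => L (s y)) w.1 v
      * b w.2) w (v, 0) = L (LineDeriv.lineDerivOp v (LineDeriv.lineDerivOp v s) w.1) * b w.2 := by
    intro v w
    have e1 := congrFun (apply_lineDerivOp L s v)
    have e2 := congrFun (apply_lineDerivOp L (LineDeriv.lineDerivOp v s) v)
    simp_rw [← e1]
    rw [fderiv_tensor (hd _) hbd, ← e2]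
  simp_rw [h3]
  congr 2
  rw [hP, SchwartzMap.laplacian_eq_sum (EuclideanSpace.basisFun (Fin 3) ℝ)]
  simp [_root_.sum_apply, Finset.sum_mul, EuclideanSpace.basisFun_apply]

end WeakDerivatives

/-! ### Plancherel for the gradient and the Laplacian on fibers. -/

section FiberPlancherel

theorem hasTemperateGrowth_lineDeriv_symbol (m : X) :
    (fun η : X => -(2 * Real.pi * Complex.I) * ((⟪η, m⟫_ℝ : ℝ) : ℂ)).HasTemperateGrowth := by
  have h : (fun η : X => ⟪η, m⟫_ℝ).HasTemperateGrowth := by fun_prop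
  have h2 := Function.Complex.hasTemperateGrowth_ofReal.comp h
  exact (Function.HasTemperateGrowth.const _).mul h2

theorem neg_lineDerivOp_fourierInv (m : X) (s : 𝓢(X, ℂ)) :
    -LineDeriv.lineDerivOp m (𝓕⁻ s) = 𝓕⁻ (SchwartzMap.smulLeftCLM ℂ
      (fun η : X => -(2 * Real.pi * Complex.I) * ((⟪η, m⟫_ℝ : ℝ) : ℂ)) s) := by
  have h : (fun η : X => ⟪η, m⟫_ℝ).HasTemperateGrowth := by fun_prop
  rw [SchwartzMap.lineDerivOp_fourierInv_eq, ← FourierTransform.fourierInv_neg]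
  congr 1
  ext η
  rw [neg_apply, smul_apply,
    SchwartzMap.smulLeftCLM_apply_apply (hasTemperateGrowth_lineDeriv_symbol m),
    SchwartzMap.smulLeftCLM_apply_apply h, Complex.real_smul, smul_eq_mul, smul_eq_mul]
  ring

theorem hasTemperateGrowth_laplacian_symbol :
    (fun η : X => ((-(2 * Real.pi * ‖η‖) ^ 2 : ℝ) : ℂ)).HasTemperateGrowth := by
  have hn : (fun η : X => ‖η‖ ^ 2).HasTemperateGrowth := Function.hasTemperateGrowth_norm_sq X
  have h : (fun η : X => -(2 * Real.pi) ^ 2 * ‖η‖ ^ 2).HasTemperateGrowth :=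
    (Function.HasTemperateGrowth.const _).mul hn
  have h2 := Function.Complex.hasTemperateGrowth_ofReal.comp h
  refine (congrArg Function.HasTemperateGrowth (funext fun η => ?_)).mp h2
  simp only [Function.comp_apply]
  congr 1
  ring

theorem laplacian_fourierInv (s : 𝓢(X, ℂ)) :
    Laplacian.laplacian (𝓕⁻ s) = 𝓕⁻ (SchwartzMap.smulLeftCLM ℂ
      (fun η : X => ((-(2 * Real.pi * ‖η‖) ^ 2 : ℝ) : ℂ)) s) := by
  have hn : (fun η : X => ‖η‖ ^ 2).HasTemperateGrowth := Function.hasTemperateGrowth_norm_sq X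
  rw [SchwartzMap.laplacian_eq_fourierMultiplierCLM, SchwartzMap.fourierMultiplierCLM_apply,
    FourierTransform.fourier_fourierInv_eq, ← FourierTransform.fourierInv_smul]
  congr 1
  ext η
  rw [smul_apply, SchwartzMap.smulLeftCLM_apply_apply hasTemperateGrowth_laplacian_symbol]
  erw [SchwartzMap.smulLeftCLM_apply_apply hn]
  rw [Complex.real_smul, Complex.real_smul, smul_eq_mul]
  push_cast
  ring

theorem enorm_sq_eq_sum (v : EuclideanSpace ℂ (Fin 3)) : ‖v‖ₑ ^ 2 = ∑ i, ‖v i‖ₑ ^ 2 := by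
  have h : ∀ {F : Type} [NormedAddCommGroup F] (a : F), ‖a‖ₑ ^ 2 = ENNReal.ofReal (‖a‖ ^ 2) :=
    fun a => by rw [← ofReal_norm, ENNReal.ofReal_pow (norm_nonneg _)]
  simp_rw [h]
  rw [EuclideanSpace.norm_sq_eq, ENNReal.ofReal_sum_of_nonneg fun _ _ => by positivity]

theorem memLp_coord {G : Phase → EuclideanSpace ℂ (Fin 3)} (hG : MemLp G 2 volume) (i : Fin 3) :
    MemLp (fun z => G z i) 2 volume :=
  (EuclideanSpace.proj (𝕜 := ℂ) i : EuclideanSpace ℂ (Fin 3) →L[ℂ] ℂ).comp_memLp' hG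

/-- Plancherel's formula for the gradient in `x` on almost every fiber. -/
theorem IsWeakGradX.ae_lintegral_fourierInv {f : Phase → ℂ} {G : Phase → EuclideanSpace ℂ (Fin 3)}
    (h : IsWeakGradX f G) (hf : MemLp f 2 volume) (hG : MemLp G 2 volume) :
    ∀ᵐ ξ : X, ∀ hu : MemLp (fun x : X => f (x, ξ)) 2 volume,
      ∫⁻ η, (ENNReal.ofReal (2 * Real.pi * ‖η‖) * ‖(𝓕⁻ (hu.toLp _) : L2X) η‖ₑ) ^ 2
        = ∫⁻ x, ‖G (x, ξ)‖ₑ ^ 2 := by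
  have h1 : ∀ᵐ ξ : X, ∀ i : Fin 3, ∀ s : 𝓢(X, ℂ),
      ∫ x, (-LineDeriv.lineDerivOp (EuclideanSpace.single i (1 : ℝ) : X) s) x * f (x, ξ)
        = ∫ x, s x * G (x, ξ) i :=
    ae_all_iff.2 fun i => (h i).ae_fiber hf (memLp_coord hG i)
  have h2 : ∀ᵐ ξ : X, ∀ i : Fin 3, MemLp (fun x : X => G (x, ξ) i) 2 volume :=
    ae_all_iff.2 fun i => ae_memLp_fiber (memLp_coord hG i)
  filter_upwards [h1, h2] with ξ h1 h2 hu
  set U : L2X := 𝓕⁻ (hu.toLp _)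
  -- The components of the transformed gradient are `-2πi ηᵢ U`; their squared moduli add up to
  -- `(2π‖η‖)² |U|²`.
  have h3 : ∀ᵐ η : X, ∀ i : Fin 3,
      -(2 * Real.pi * Complex.I) * ((⟪η, EuclideanSpace.single i 1⟫_ℝ : ℝ) : ℂ) * U η
        = (𝓕⁻ ((h2 i).toLp _) : L2X) η :=
    ae_all_iff.2 fun i => fourierInv_multiplier_ae hu (h2 i)
      (hasTemperateGrowth_lineDeriv_symbol (EuclideanSpace.single i 1)) fun s => by
        rw [← neg_lineDerivOp_fourierInv]; exact h1 i _
  calc _ = ∫⁻ η, ∑ i, ‖(𝓕⁻ ((h2 i).toLp _) : L2X) η‖ₑ ^ 2 := by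
        refine lintegral_congr_ae ?_
        filter_upwards [h3] with η hη
        have h4 : ∀ {F : Type} [NormedAddCommGroup F] (a : F),
            ‖a‖ₑ ^ 2 = ENNReal.ofReal (‖a‖ ^ 2) :=
          fun a => by rw [← ofReal_norm, ENNReal.ofReal_pow (norm_nonneg _)]
        rw [mul_pow, h4, ← ENNReal.ofReal_pow (by positivity),
          ← ENNReal.ofReal_mul (by positivity)]
        simp_rw [h4]
        rw [← ENNReal.ofReal_sum_of_nonneg fun _ _ => by positivity]
        congr 1
        simp_rw [← hη, norm_mul, mul_pow, norm_neg, norm_mul, Complex.norm_I, Complex.norm_real,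
          mul_pow, EuclideanSpace.inner_single_right]
        rw [EuclideanSpace.norm_sq_eq, ← Finset.sum_mul, ← Finset.mul_sum]
        simp [abs_of_pos Real.pi_pos]
    _ = ∑ i, ∫⁻ x, ‖G (x, ξ) i‖ₑ ^ 2 := by
        rw [lintegral_finsetSum' _ fun i _ => (Lp.aestronglyMeasurable _).enorm.pow_const 2]
        exact Finset.sum_congr rfl fun i _ => lintegral_fourierInv_sq (h2 i)
    _ = _ := by
        simp_rw [enorm_sq_eq_sum]
        rw [lintegral_finsetSum' _ fun i _ => (h2 i).1.enorm.pow_const 2]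

/-- Plancherel's formula for the Laplacian in `x` on almost every fiber. -/
theorem IsWeakLaplacianX.ae_lintegral_fourierInv {f g : Phase → ℂ}
    (h : IsWeakLaplacianX f g) (hf : MemLp f 2 volume) (hg : MemLp g 2 volume) :
    ∀ᵐ ξ : X, ∀ hu : MemLp (fun x : X => f (x, ξ)) 2 volume,
      ∫⁻ η, (ENNReal.ofReal ((2 * Real.pi * ‖η‖) ^ 2) * ‖(𝓕⁻ (hu.toLp _) : L2X) η‖ₑ) ^ 2
        = ∫⁻ x, ‖g (x, ξ)‖ₑ ^ 2 := by
  filter_upwards [h.ae_fiber hf hg, ae_memLp_fiber hg] with ξ h1 h2 hu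
  have h3 := fourierInv_multiplier_ae hu h2 hasTemperateGrowth_laplacian_symbol fun s => by
    rw [← laplacian_fourierInv]; exact h1 _
  rw [← lintegral_fourierInv_sq h2]
  refine lintegral_congr_ae ?_
  filter_upwards [h3] with η hη
  rw [← hη, enorm_mul]
  congr 2
  rw [← ofReal_norm, Complex.norm_real, norm_neg, Real.norm_of_nonneg (by positivity)]

end FiberPlancherel

/-! ### The Wigner transform as an inverse Fourier transform, and its norms. -/

section WignerSymbol

/-- The Schwartz function `η ↦ s (a + c η)`. -/
def affineComp (a : X) (c : ℝˣ) (s : 𝓢(X, ℂ)) : 𝓢(X, ℂ) :=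
  SchwartzMap.compCLMOfContinuousLinearEquiv ℂ
    (ContinuousLinearEquiv.smulLeft (R₁ := ℝ) (M₁ := X) c) (s.compSubConstCLM ℂ (-a))

theorem affineComp_apply (a : X) (c : ℝˣ) (s : 𝓢(X, ℂ)) (η : X) :
    affineComp a c s η = s (a + (c : ℝ) • η) := by
  rw [affineComp, SchwartzMap.compCLMOfContinuousLinearEquiv_apply, Function.comp_apply,
    SchwartzMap.compSubConstCLM_apply, sub_neg_eq_add, add_comm]
  rfl

/-- The Fourier transform in `x` of the Wigner transform of `φ ⊗ ψ̄`, at the momentum `ξ`. -/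
def wignerSymbol (h : ℝ) (φ ψ : 𝓢(X, ℂ)) (ξ : X) : 𝓢(X, ℂ) :=
  SchwartzMap.pairing (ContinuousLinearMap.mul ℂ ℂ)
    (affineComp (h⁻¹ • ξ) (Units.mk0 (1 / 2) (by norm_num)) (𝓕 φ))
    ((affineComp (h⁻¹ • ξ) (Units.mk0 (-(1 / 2)) (by norm_num)) (𝓕 ψ)).postcompCLM
      (Complex.conjCLE : ℂ →L[ℝ] ℂ))

theorem wignerSymbol_apply (h : ℝ) (φ ψ : 𝓢(X, ℂ)) (ξ η : X) :
    wignerSymbol h φ ψ ξ η =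
      𝓕 φ (h⁻¹ • ξ + (1 / 2 : ℝ) • η) * conj (𝓕 ψ (h⁻¹ • ξ - (1 / 2 : ℝ) • η)) := by
  rw [wignerSymbol, SchwartzMap.pairing_apply_apply, affineComp_apply,
    SchwartzMap.postcompCLM_apply, affineComp_apply, Units.val_mk0, Units.val_mk0, neg_smul,
    ← sub_eq_add_neg]
  rfl

theorem integral_comp_half_smul {F : Type*} [NormedAddCommGroup F] [NormedSpace ℝ F] (f : X → F) :
    ∫ x, f ((1 / 2 : ℝ) • x) = (8 : ℝ) • ∫ x, f x := by
  rw [Measure.integral_comp_smul]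
  have hd : Module.finrank ℝ X = 3 := by simp
  rw [hd]
  norm_num

/-- The Wigner transform of `φ ⊗ ψ̄` is an inverse Fourier transform at fixed momentum. -/
theorem wigner_eq_fourierInv (h : ℝ) (φ ψ : 𝓢(X, ℂ)) (z : Phase) :
    wigner h (fun x y => φ x * conj (ψ y)) z = (𝓕⁻ (wignerSymbol h φ ψ z.2)) z.1 := by
  obtain ⟨x, ξ⟩ := z
  set a : X := h⁻¹ • ξ
  let e : ℝ → ℂ := fun t => Complex.exp ((2 * Real.pi * t : ℝ) * Complex.I)
  have he1 : ∀ t, ‖e t‖ = 1 := fun t => Complex.norm_exp_ofReal_mul_I _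
  have hec : Continuous e := by simp only [e]; fun_prop
  have hadd : ∀ s t, e (s + t) = e s * e t := fun s t => by
    simp only [e]; rw [← Complex.exp_add]; congr 1; push_cast; ring
  have hconj : ∀ t, conj (e t) = e (-t) := fun t => by
    simp only [e]
    rw [← Complex.exp_conj, map_mul, Complex.conj_ofReal, Complex.conj_I]
    congr 1; push_cast; ring
  have hF : ∀ (s : 𝓢(X, ℂ)) (p : X), 𝓕 s p = ∫ t, e (-⟪t, p⟫_ℝ) * s t := fun s p => by
    rw [SchwartzMap.fourier_coe, Real.fourier_eq']
    refine integral_congr_ae (Filter.Eventually.of_forall fun t => ?_)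
    simp only [e, smul_eq_mul]
    congr 3; ring_nf
  have hFi : ∀ (s : 𝓢(X, ℂ)) (p : X), (𝓕⁻ s) p = ∫ t, e ⟪t, p⟫_ℝ * s t := fun s p => by
    rw [SchwartzMap.fourierInv_coe, Real.fourierInv_eq']
    rfl
  -- The integrand after `φ` is replaced by its Fourier inversion integral over `p`; integrating in
  -- `y` first then produces the Fourier transform of `ψ`.
  let H : X × X → ℂ := fun q =>
    e (⟪q.2, x + (1 / 2 : ℝ) • q.1⟫_ℝ - ⟪a, q.1⟫_ℝ) *
      (conj (ψ (x - (1 / 2 : ℝ) • q.1)) * 𝓕 φ q.2)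
  have hψi : Integrable (fun y : X => conj (ψ (x - (1 / 2 : ℝ) • y))) volume := by
    have h1 := ((ψ.integrable (μ := volume)).comp_sub_left x).comp_smul (R := (1 / 2 : ℝ))
      (by norm_num)
    exact (Complex.conjCLE : ℂ →L[ℝ] ℂ).integrable_comp h1
  have hH : Integrable H (volume.prod volume) := by
    have h1 := hψi.mul_prod ((𝓕 φ).integrable (μ := volume))
    refine h1.bdd_mul (c := 1) ?_ (Filter.Eventually.of_forall fun q => (he1 _).le)
    exact (hec.comp (by fun_prop)).aestronglyMeasurable
  -- The substitution `t = x - y/2` has Jacobian `8 = 2³`, which the substitution `p = a + η/2`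
  -- cancels at the end.
  have hinner : ∀ p, ∫ y, H (y, p) =
      (8 : ℝ) • (𝓕 φ p * (e (2 * ⟪p - a, x⟫_ℝ) * conj (𝓕 ψ ((2 : ℝ) • a - p)))) := by
    intro p
    let g : X → ℂ := fun t => e (2 * ⟪p - a, x⟫_ℝ + ⟪t, (2 : ℝ) • a - p⟫_ℝ) * conj (ψ t) * 𝓕 φ p
    have h1 : ∀ y, H (y, p) = g (x - (1 / 2 : ℝ) • y) := fun y => by
      have : ⟪p, x + (1 / 2 : ℝ) • y⟫_ℝ - ⟪a, y⟫_ℝ =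
          2 * ⟪p - a, x⟫_ℝ + ⟪x - (1 / 2 : ℝ) • y, (2 : ℝ) • a - p⟫_ℝ := by
        simp only [inner_add_right, inner_sub_left, inner_sub_right, real_inner_smul_left,
          real_inner_smul_right]
        rw [real_inner_comm a x, real_inner_comm p x, real_inner_comm a y, real_inner_comm p y]
        ring
      simp only [H, g, this]
      ring
    simp_rw [h1]
    rw [integral_comp_half_smul (fun y => g (x - y)), integral_sub_left_eq_self g volume x]
    congr 1
    simp only [g]
    rw [integral_mul_const, mul_comm, hF ψ, ← integral_conj, ← integral_const_mul,
      ← integral_const_mul, ← integral_const_mul]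
    refine integral_congr_ae (Filter.Eventually.of_forall fun t => ?_)
    simp only [hadd, map_mul, hconj, neg_neg]
    ring
  calc wigner h (fun x y => φ x * conj (ψ y)) (x, ξ) = ∫ y, ∫ p, H (y, p) := by
        rw [wigner]
        refine integral_congr_ae (Filter.Eventually.of_forall fun y => ?_)
        have h1 : φ (x + (1 / 2 : ℝ) • y) =
            ∫ p, e ⟪p, x + (1 / 2 : ℝ) • y⟫_ℝ * 𝓕 φ p := by
          rw [← hFi, FourierTransform.fourierInv_fourier_eq]
        have h2 : Complex.exp (-2 * Real.pi * Complex.I * ((⟪ξ, y⟫_ℝ / h : ℝ) : ℂ))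
            = e (-⟪a, y⟫_ℝ) := by
          simp only [e, a, real_inner_smul_left]
          congr 1; push_cast; ring
        simp only [h1, h2]
        rw [← integral_mul_const, ← integral_const_mul]
        refine integral_congr_ae (Filter.Eventually.of_forall fun p => ?_)
        simp only [H, sub_eq_add_neg, hadd]
        ring
    _ = ∫ p, ∫ y, H (y, p) := integral_integral_swap (f := fun y p => H (y, p)) hH
    _ = (𝓕⁻ (wignerSymbol h φ ψ ξ) : 𝓢(X, ℂ)) x := by
        simp_rw [hinner]
        rw [integral_smul, ← integral_comp_half_smul (F := ℂ),
          ← integral_add_left_eq_self _ ((2 : ℝ) • a), hFi]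
        refine integral_congr_ae (Filter.Eventually.of_forall fun η => ?_)
        have h1 : (1 / 2 : ℝ) • ((2 : ℝ) • a + η) = a + (1 / 2 : ℝ) • η := by module
        have h2 : (2 : ℝ) • a - (a + (1 / 2 : ℝ) • η) = a - (1 / 2 : ℝ) • η := by module
        have h3 : 2 * ⟪a + (1 / 2 : ℝ) • η - a, x⟫_ℝ = ⟪η, x⟫_ℝ := by
          rw [add_sub_cancel_left, real_inner_smul_left]; ring
        simp only [h1, h2, h3, wignerSymbol_apply]
        ring

theorem fourier_bracketP (h : ℝ) (φ : 𝓢(X, ℂ)) (ζ : X) :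
    𝓕 (bracketP h φ) ζ = (bracket (h • ζ) : ℂ) * 𝓕 φ ζ := by
  rw [bracketP, SchwartzMap.fourierMultiplierCLM_apply, FourierTransform.fourier_fourierInv_eq,
    SchwartzMap.smulLeftCLM_apply_apply (bracket_hasTemperateGrowth h), smul_eq_mul]

/-- `φ̂` is evaluated at `ζ = ξ/h + η/2`, where the multiplier of `⟨p⟩` is `⟨hζ⟩ = ⟨ξ + hη/2⟩`. -/
theorem wignerSymbol_bracketP_left {h : ℝ} (hh : h ≠ 0) (φ ψ : 𝓢(X, ℂ)) (ξ η : X) :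
    wignerSymbol h (bracketP h φ) ψ ξ η =
      (bracket (ξ + (h / 2) • η) : ℂ) * wignerSymbol h φ ψ ξ η := by
  rw [wignerSymbol_apply, wignerSymbol_apply, fourier_bracketP, smul_add, smul_inv_smul₀ hh,
    smul_smul, mul_one_div, mul_assoc]

theorem wignerSymbol_bracketP_right {h : ℝ} (hh : h ≠ 0) (φ ψ : 𝓢(X, ℂ)) (ξ η : X) :
    wignerSymbol h φ (bracketP h ψ) ξ η =
      (bracket (ξ - (h / 2) • η) : ℂ) * wignerSymbol h φ ψ ξ η := by
  rw [wignerSymbol_apply, wignerSymbol_apply, fourier_bracketP, smul_sub, smul_inv_smul₀ hh,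
    smul_smul, mul_one_div, map_mul, Complex.conj_ofReal]
  ring

theorem lintegral_comp_inv_smul {h : ℝ} (hh : 0 < h) {F : X → ℝ≥0∞} (hF : Measurable F) :
    ∫⁻ x, F (h⁻¹ • x) = ENNReal.ofReal (h ^ 3) * ∫⁻ x, F x := by
  have h1 := Measure.map_addHaar_smul (volume : Measure X) (inv_ne_zero hh.ne')
  have hd : Module.finrank ℝ X = 3 := by simp
  rw [← lintegral_map hF (measurable_const_smul _), h1, lintegral_smul_measure, hd, inv_pow,
    inv_inv, abs_of_pos (by positivity), smul_eq_mul]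

/-- The change of variables `(ξ, η) ↦ (ξ / h + η / 2, ξ / h - η / 2)`. -/
theorem lintegral_momenta {h : ℝ} (hh : 0 < h) {F : X × X → ℝ≥0∞} (hF : Measurable F) :
    ∫⁻ ξ : X, ∫⁻ η : X, F (h⁻¹ • ξ + (1 / 2 : ℝ) • η, h⁻¹ • ξ - (1 / 2 : ℝ) • η)
      = ENNReal.ofReal (h ^ 3) * ∫⁻ p : X, ∫⁻ q : X, F (p, q) := by
  have hm : Measurable fun r : X × X => F (r.1 + (1 / 2 : ℝ) • r.2, r.1 - (1 / 2 : ℝ) • r.2) :=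
    hF.comp (by fun_prop)
  have hm2 : Measurable fun r : X × X => F (r.1, r.1 - r.2) := hF.comp (by fun_prop)
  -- The factor `h³` comes from `a = ξ/h` alone; `(a, η) ↦ (a + η/2, a - η/2)` preserves volume,
  -- being a translation in `a` followed by a reflection and translation in `η`.
  rw [lintegral_comp_inv_smul hh
    (F := fun ξ => ∫⁻ η : X, F (ξ + (1 / 2 : ℝ) • η, ξ - (1 / 2 : ℝ) • η)) hm.lintegral_prod_right']
  congr 1
  calc _ = ∫⁻ η : X, ∫⁻ a : X, F (a + (1 / 2 : ℝ) • η, a - (1 / 2 : ℝ) • η) :=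
        lintegral_lintegral_swap
          (f := fun a η => F (a + (1 / 2 : ℝ) • η, a - (1 / 2 : ℝ) • η)) hm.aemeasurable
    _ = ∫⁻ η : X, ∫⁻ p : X, F (p, p - η) := by
        refine lintegral_congr fun η => ?_
        rw [← lintegral_add_left_eq_self (fun p => F (p, p - η)) ((1 / 2 : ℝ) • η)]
        refine lintegral_congr fun a => ?_
        congr 2 <;> module
    _ = ∫⁻ p : X, ∫⁻ η : X, F (p, p - η) :=
        (lintegral_lintegral_swap (f := fun p η => F (p, p - η)) hm2.aemeasurable).symm
    _ = _ := lintegral_congr fun p => lintegral_sub_left_eq_self (fun q => F (p, q)) p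

theorem inner_toLp (s t : 𝓢(X, ℂ)) :
    ⟪s.toLp 2 volume, t.toLp 2 volume⟫_ℂ = ∫ x, t x * conj (s x) := by
  rw [L2.inner_def]
  refine integral_congr_ae ?_
  filter_upwards [s.coeFn_toLp 2, t.coeFn_toLp 2] with x h1 h2
  rw [h1, h2, RCLike.inner_apply]

theorem integrable_schwartz_mul_conj (s t : 𝓢(X, ℂ)) :
    Integrable (fun x => t x * conj (s x)) volume := by
  have hs : MemLp (fun x => conj (s x)) 2 (volume : Measure X) :=
    MemLp.star (f := fun x => s x) (s.memLp 2)
  exact (t.memLp 2).integrable_mul hs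

theorem continuous_sum_tensor {ι : Type} [Fintype ι] (c : ι → ℂ) (φ ψ : ι → 𝓢(X, ℂ)) :
    Continuous fun r : X × X => ∑ i, c i * (φ i r.1 * conj (ψ i r.2)) :=
  continuous_finsetSum _ fun i _ => continuous_const.mul
    (((φ i).continuous.comp continuous_fst).mul
      (Complex.continuous_conj.comp ((ψ i).continuous.comp continuous_snd)))

/-- The Hilbert-Schmidt norm of a finite rank operator with Schwartz kernel. -/
theorem integral_sum_tensor_sq {ι : Type} [Fintype ι] (c : ι → ℂ) (φ ψ : ι → 𝓢(X, ℂ)) :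
    Integrable (fun r : X × X => ‖∑ i, c i * (φ i r.1 * conj (ψ i r.2))‖ ^ 2)
        (volume.prod volume) ∧
      ∫ r : X × X, ‖∑ i, c i * (φ i r.1 * conj (ψ i r.2))‖ ^ 2 ∂(volume.prod volume) =
        (∑ i, ∑ l, c i * conj (c l) *
          (⟪(φ l).toLp 2 volume, (φ i).toLp 2 volume⟫_ℂ *
            ⟪(ψ i).toLp 2 volume, (ψ l).toLp 2 volume⟫_ℂ)).re := by
  have hsum : ∀ r : X × X, ((‖∑ i, c i * (φ i r.1 * conj (ψ i r.2))‖ ^ 2 : ℝ) : ℂ) =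
      ∑ i, ∑ l, c i * conj (c l) *
        ((φ i r.1 * conj (φ l r.1)) * (ψ l r.2 * conj (ψ i r.2))) := by
    intro r
    rw [Complex.ofReal_pow, ← Complex.mul_conj']
    simp only [map_sum, map_mul, Complex.conj_conj, Finset.sum_mul_sum]
    exact Finset.sum_congr rfl fun i _ => Finset.sum_congr rfl fun l _ => by ring
  have hint : ∀ i l, Integrable (fun r : X × X => c i * conj (c l) *
      ((φ i r.1 * conj (φ l r.1)) * (ψ l r.2 * conj (ψ i r.2)))) (volume.prod volume) := fun i l =>
    ((integrable_schwartz_mul_conj (φ l) (φ i)).mul_prod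
      (integrable_schwartz_mul_conj (ψ i) (ψ l))).const_mul _
  have hKi : Integrable (fun r : X × X =>
      ((‖∑ i, c i * (φ i r.1 * conj (ψ i r.2))‖ ^ 2 : ℝ) : ℂ)) (volume.prod volume) := by
    simp_rw [hsum]
    exact integrable_finsetSum _ fun i _ => integrable_finsetSum _ fun l _ => hint i l
  refine ⟨by simpa only [RCLike.re_to_complex, Complex.ofReal_re] using hKi.re, ?_⟩
  rw [← Complex.ofReal_re (∫ r : X × X, _ ∂_), ← integral_complex_ofReal]
  congr 1
  simp_rw [hsum]
  rw [integral_finsetSum _ fun i _ => integrable_finsetSum _ fun l _ => hint i l]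
  refine Finset.sum_congr rfl fun i _ => ?_
  rw [integral_finsetSum _ fun l _ => hint i l]
  refine Finset.sum_congr rfl fun l _ => ?_
  rw [integral_const_mul, integral_prod_mul (fun x => φ i x * conj (φ l x))
    (fun x => ψ l x * conj (ψ i x)), ← inner_toLp, ← inner_toLp]

/-- The norm of a finite rank operator with Schwartz kernel, in terms of its symbol. -/
theorem lintegral_sum_wignerSymbol_sq {h : ℝ} (hh : 0 < h) {ι : Type} [Fintype ι] (c : ι → ℂ)
    (φ ψ : ι → 𝓢(X, ℂ)) :
    ∫⁻ ξ : X, ∫⁻ η : X, ‖∑ i, c i * wignerSymbol h (φ i) (ψ i) ξ η‖ₑ ^ 2 =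
      ENNReal.ofReal (h ^ 3) * ENNReal.ofReal (∑ i, ∑ l, c i * conj (c l) *
        (⟪(φ l).toLp 2 volume, (φ i).toLp 2 volume⟫_ℂ *
          ⟪(ψ i).toLp 2 volume, (ψ l).toLp 2 volume⟫_ℂ)).re := by
  have hK := continuous_sum_tensor c (fun i => 𝓕 (φ i)) (fun i => 𝓕 (ψ i))
  set K : X × X → ℂ := fun r => ∑ i, c i * (𝓕 (φ i) r.1 * conj (𝓕 (ψ i) r.2))
  have hKm : Measurable fun r => ‖K r‖ₑ ^ 2 := by fun_prop
  obtain ⟨hKi, hval⟩ := integral_sum_tensor_sq c (fun i => 𝓕 (φ i)) (fun i => 𝓕 (ψ i))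
  -- Plancherel removes the Fourier transforms from the Gram matrices of the `φᵢ` and the `ψᵢ`.
  simp only [SchwartzMap.inner_fourier_toL2_eq] at hval
  simp_rw [wignerSymbol_apply]
  rw [lintegral_momenta hh (F := fun r => ‖K r‖ₑ ^ 2) hKm, ← hval,
    ofReal_integral_eq_lintegral_ofReal hKi (Filter.Eventually.of_forall fun r => by positivity),
    lintegral_prod _ (by fun_prop)]
  congr 1
  refine lintegral_congr fun p => lintegral_congr fun q => ?_
  rw [← ofReal_norm, ENNReal.ofReal_pow (norm_nonneg _)]

theorem aestronglyMeasurable_wigner (h : ℝ) (φ ψ : 𝓢(X, ℂ)) :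
    AEStronglyMeasurable (wigner h fun x y => φ x * conj (ψ y)) (volume : Measure Phase) := by
  have hc : Continuous fun q : Phase × X =>
      Complex.exp (-2 * Real.pi * Complex.I * ((⟪q.1.2, q.2⟫_ℝ / h : ℝ) : ℂ)) *
        (φ (q.1.1 + (1 / 2 : ℝ) • q.2) * conj (ψ (q.1.1 - (1 / 2 : ℝ) • q.2))) := by
    have h1 := φ.continuous
    have h2 := ψ.continuous
    have h3 : Continuous fun q : Phase × X => ⟪q.1.2, q.2⟫_ℝ / h := by fun_prop
    refine Continuous.mul (by fun_prop) ((h1.comp (by fun_prop)).mul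
      (Complex.continuous_conj.comp (h2.comp (by fun_prop))))
  exact (hc.stronglyMeasurable.integral_prod_right' (ν := volume)).aestronglyMeasurable

theorem continuous_bracket : Continuous bracket := by
  unfold bracket
  fun_prop

/-- The Wigner transform of Schwartz functions decays fast in `ξ`, in the mean square sense. -/
theorem memLp_bracket_pow_mul_wigner {h : ℝ} (hh : 0 < h) (φ ψ : 𝓢(X, ℂ)) {j : ℕ} (hj : j ≤ 2) :
    MemLp (fun z : Phase => (bracket z.2 : ℂ) ^ j * wigner h (fun x y => φ x * conj (ψ y)) z) 2
      volume := by
  have hm : AEStronglyMeasurable (fun z : Phase =>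
      (bracket z.2 : ℂ) ^ j * wigner h (fun x y => φ x * conj (ψ y)) z) volume := by
    have hb : Continuous fun z : Phase => (bracket z.2 : ℂ) ^ j := by
      have := continuous_bracket
      fun_prop
    exact hb.aestronglyMeasurable.mul (aestronglyMeasurable_wigner h φ ψ)
  refine ⟨hm, ?_⟩
  -- Two brackets on each side give the symbol the factor `(⟨ξ + hη/2⟩⟨ξ - hη/2⟩)²`, which dominates
  -- `⟨ξ⟩²` and hence `⟨ξ⟩ʲ` for `j ≤ 2`.
  set Φ := bracketP h (bracketP h φ)
  set Ψ := bracketP h (bracketP h ψ)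
  have hfin : ∫⁻ ξ : X, ∫⁻ η : X, ‖wignerSymbol h Φ Ψ ξ η‖ₑ ^ 2 < ⊤ := by
    have h1 := lintegral_sum_wignerSymbol_sq hh (fun _ : Unit => 1) (fun _ => Φ) (fun _ => Ψ)
    simp only [Finset.univ_unique, Finset.sum_singleton, one_mul] at h1
    rw [h1]
    exact ENNReal.mul_lt_top ENNReal.ofReal_lt_top ENNReal.ofReal_lt_top
  have hpt : ∀ ξ η : X, ‖(bracket ξ : ℂ) ^ j * wignerSymbol h φ ψ ξ η‖ₑ ≤
      ‖wignerSymbol h Φ Ψ ξ η‖ₑ := by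
    intro ξ η
    rw [wignerSymbol_bracketP_left hh.ne', wignerSymbol_bracketP_left hh.ne',
      wignerSymbol_bracketP_right hh.ne', wignerSymbol_bracketP_right hh.ne', ← ofReal_norm,
      ← ofReal_norm]
    refine ENNReal.ofReal_le_ofReal ?_
    have hp := one_le_bracket (ξ + (h / 2) • η)
    have hq := one_le_bracket (ξ - (h / 2) • η)
    have h0 := one_le_bracket ξ
    have hle := bracket_le_mul ξ ((h / 2) • η)
    simp only [norm_mul, norm_pow, Complex.norm_real, Real.norm_eq_abs]
    rw [abs_of_pos (by linarith), abs_of_pos (by linarith), abs_of_pos (by linarith)]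
    calc _ ≤ bracket ξ ^ 2 * ‖wignerSymbol h φ ψ ξ η‖ := by gcongr
      _ ≤ (bracket (ξ + (h / 2) • η) * bracket (ξ - (h / 2) • η)) ^ 2 *
          ‖wignerSymbol h φ ψ ξ η‖ := by gcongr
      _ = _ := by ring
  have hle : ∫⁻ z : Phase, ‖(bracket z.2 : ℂ) ^ j * wigner h (fun x y => φ x * conj (ψ y)) z‖ₑ ^ 2
      ≤ ∫⁻ ξ : X, ∫⁻ η : X, ‖wignerSymbol h Φ Ψ ξ η‖ₑ ^ 2 := by
    rw [Measure.volume_eq_prod, lintegral_prod_symm _ (hm.enorm.pow_const 2)]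
    refine lintegral_mono fun ξ => ?_
    simp_rw [wigner_eq_fourierInv, enorm_mul, mul_pow]
    rw [lintegral_const_mul _ (by fun_prop), lintegral_schwartz_fourierInv_sq,
      ← lintegral_const_mul _ (by fun_prop)]
    refine lintegral_mono fun η => ?_
    have := hpt ξ η
    rw [enorm_mul] at this
    rw [← mul_pow]
    exact pow_le_pow_left' this 2
  refine lt_top_iff_ne_top.2 fun htop => ?_
  have h2 := hle.trans_lt hfin
  rw [← eLpNorm_two_sq, htop] at h2
  simp at h2

end WignerSymbol

/-! ### From a pointwise multiplier bound to a Hilbert-Schmidt bound. -/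

section SymbolBound

theorem continuous_sum_wignerSymbol (h : ℝ) {ι : Type} [Fintype ι] (c : ι → ℂ)
    (φ ψ : ι → 𝓢(X, ℂ)) :
    Continuous fun r : X × X => ∑ i, c i * wignerSymbol h (φ i) (ψ i) r.1 r.2 := by
  simp_rw [wignerSymbol_apply]
  refine continuous_finsetSum _ fun i _ => continuous_const.mul
    (((𝓕 (φ i)).continuous.comp (by fun_prop)).mul
      (Complex.continuous_conj.comp ((𝓕 (ψ i)).continuous.comp (by fun_prop))))

theorem fourierInv_sum_smul_apply {ι : Type} [Fintype ι] (c : ι → ℂ) (κ : ι → 𝓢(X, ℂ)) (x : X) :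
    (𝓕⁻ (∑ i, c i • κ i) : 𝓢(X, ℂ)) x = ∑ i, c i * (𝓕⁻ (κ i) : 𝓢(X, ℂ)) x := by
  have h : (𝓕⁻ (∑ i, c i • κ i) : 𝓢(X, ℂ)) = ∑ i, c i • (𝓕⁻ (κ i) : 𝓢(X, ℂ)) := by
    have := map_sum (FourierTransform.fourierInvCLM ℂ 𝓢(X, ℂ)) (fun i => c i • κ i) Finset.univ
    simpa only [map_smul, FourierTransform.fourierInvCLM_apply] using this
  rw [h, _root_.sum_apply]
  rfl

variable {h : ℝ} {f : Phase → ℂ} {ε : Type*} [NormedAddCommGroup ε] {G : Phase → ε}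
  {w : X → ℝ≥0∞} {T : WeakOp} {κ : 𝓢(X, ℂ) → 𝓢(X, ℂ) → X → 𝓢(X, ℂ)} {m : X → X → ℂ} {C : ℝ}

/-- Two applications of Cauchy-Schwarz. On each fiber the bound on `m` moves the weight `w` onto the
transform of `f`, where `hPl` identifies the result with the norm of `G`, and leaves the symbol of
the tensor unweighted; the second application is in `ξ`. -/
theorem enorm_sum_symbol_sq_le (hh : 0 < h) (hf : MemLp f 2 volume) (hG : MemLp G 2 volume)
    (hw : Measurable w)
    (hPl : ∀ᵐ ξ : X, ∀ hu : MemLp (fun x : X => f (x, ξ)) 2 volume,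
      ∫⁻ η, (w η * ‖(𝓕⁻ (hu.toLp _) : L2X) η‖ₑ) ^ 2 = ∫⁻ x, ‖G (x, ξ)‖ₑ ^ 2)
    (hκ : ∀ φ ψ ξ η, κ φ ψ ξ η = m ξ η * wignerSymbol h φ ψ ξ η)
    (hm : ∀ ξ η, ‖m ξ η‖ₑ ≤ ENNReal.ofReal C * w η)
    (hint : ∀ φ ψ, Integrable (fun z : Phase => f z * (𝓕⁻ (κ φ ψ z.2) : 𝓢(X, ℂ)) z.1) volume)
    (hT : ∀ φ ψ, T φ ψ =
      ((h ^ 3)⁻¹ : ℝ) * ∫ z : Phase, f z * (𝓕⁻ (κ φ ψ z.2) : 𝓢(X, ℂ)) z.1)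
    {ι : Type} [Fintype ι] (c : ι → ℂ) (φ ψ : ι → 𝓢(X, ℂ)) :
    ‖∑ i, c i * T (φ i) (ψ i)‖ₑ ^ 2 ≤ ENNReal.ofReal (h ^ 3)⁻¹ ^ 2 * (ENNReal.ofReal C ^ 2 *
      (eLpNorm G 2 volume ^ 2 *
        ∫⁻ ξ : X, ∫⁻ η : X, ‖∑ i, c i * wignerSymbol h (φ i) (ψ i) ξ η‖ₑ ^ 2)) := by
  set A : X → ℝ≥0∞ := fun ξ => ∫⁻ x, ‖G (x, ξ)‖ₑ ^ 2
  set B : X → ℝ≥0∞ := fun ξ => ∫⁻ η, ‖∑ i, c i * wignerSymbol h (φ i) (ψ i) ξ η‖ₑ ^ 2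
  have hGm : AEStronglyMeasurable G ((volume : Measure X).prod (volume : Measure X)) := hG.1
  have hAm : AEMeasurable A volume := (hGm.enorm.pow_const 2).lintegral_prod_left'
  have hKc := continuous_sum_wignerSymbol h c φ ψ
  have hBm : Measurable B := by
    have : Measurable fun r : X × X =>
        ‖∑ i, c i * wignerSymbol h (φ i) (ψ i) r.1 r.2‖ₑ ^ 2 := hKc.measurable.enorm.pow_const 2
    exact this.lintegral_prod_right'
  have hAint : ∫⁻ ξ, A ξ = eLpNorm G 2 volume ^ 2 := by
    rw [eLpNorm_two_sq, Measure.volume_eq_prod,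
      lintegral_prod_symm _ (hGm.enorm.pow_const 2)]
  have hsumint : Integrable (fun z : Phase =>
      f z * (𝓕⁻ (∑ i, c i • κ (φ i) (ψ i) z.2) : 𝓢(X, ℂ)) z.1) volume := by
    simp_rw [fourierInv_sum_smul_apply, Finset.mul_sum]
    refine integrable_finsetSum _ fun i _ => ((hint (φ i) (ψ i)).const_mul (c i)).congr
      (Filter.Eventually.of_forall fun z => ?_)
    simp only
    ring
  have hsum : ∑ i, c i * T (φ i) (ψ i) = ((h ^ 3)⁻¹ : ℝ) *
      ∫ ξ : X, ∫ x : X, f (x, ξ) * (𝓕⁻ (∑ i, c i • κ (φ i) (ψ i) ξ) : 𝓢(X, ℂ)) x := by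
    rw [← integral_prod_symm (fun z : Phase =>
      f z * (𝓕⁻ (∑ i, c i • κ (φ i) (ψ i) z.2) : 𝓢(X, ℂ)) z.1) hsumint, ← Measure.volume_eq_prod]
    simp_rw [fourierInv_sum_smul_apply, Finset.mul_sum, hT]
    rw [integral_finsetSum, Finset.mul_sum]
    · refine Finset.sum_congr rfl fun i _ => ?_
      rw [mul_left_comm, ← integral_const_mul]
      congr 1
      refine integral_congr_ae (Filter.Eventually.of_forall fun z => ?_)
      simp only
      ring
    · refine fun i _ => ((hint (φ i) (ψ i)).const_mul (c i)).congr
        (Filter.Eventually.of_forall fun z => ?_)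
      simp only
      ring
  -- The common multiplier `m ξ η` factors out of the whole sum, so the bound sees the norm of the
  -- full tensor rather than a sum of norms.
  have hfiber : ∀ᵐ ξ : X,
      ‖∫ x : X, f (x, ξ) * (𝓕⁻ (∑ i, c i • κ (φ i) (ψ i) ξ) : 𝓢(X, ℂ)) x‖ₑ ≤
        ENNReal.ofReal C * (A ξ ^ (1 / 2 : ℝ) * B ξ ^ (1 / 2 : ℝ)) := by
    filter_upwards [hPl, ae_memLp_fiber hf] with ξ h1 hu
    have h2 := enorm_integral_fourierInv_sq_le hu hw (κ := ∑ i, c i • κ (φ i) (ψ i) ξ)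
      (K := fun η => ∑ i, c i * wignerSymbol h (φ i) (ψ i) ξ η) (C := ENNReal.ofReal C)
      (hKc.comp (by fun_prop : Continuous fun η : X => (ξ, η))).aestronglyMeasurable (fun η => by
        rw [_root_.sum_apply]
        have h3 : ∑ i, (c i • κ (φ i) (ψ i) ξ) η =
            m ξ η * ∑ i, c i * wignerSymbol h (φ i) (ψ i) ξ η := by
          rw [Finset.mul_sum]
          refine Finset.sum_congr rfl fun i _ => ?_
          rw [smul_apply, hκ, smul_eq_mul]
          ring
        rw [h3, enorm_mul, ← mul_assoc]
        gcongr
        exact hm ξ η)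
    rw [h1 hu] at h2
    have h4 : ∀ a : ℝ≥0∞, (a ^ 2) ^ (1 / 2 : ℝ) = a := fun a => by
      rw [← ENNReal.rpow_natCast, ← ENNReal.rpow_mul]; norm_num
    have h5 := ENNReal.rpow_le_rpow h2 (z := 1 / 2) (by norm_num)
    rwa [h4, ENNReal.mul_rpow_of_nonneg _ _ (by norm_num), h4,
      ENNReal.mul_rpow_of_nonneg _ _ (by norm_num)] at h5
  have h6 : ∀ a : ℝ≥0∞, (a ^ (1 / 2 : ℝ)) ^ 2 = a := fun a => by
    rw [← ENNReal.rpow_natCast, ← ENNReal.rpow_mul]; norm_num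
  rw [hsum, enorm_mul, mul_pow]
  have h7 : ‖(((h ^ 3)⁻¹ : ℝ) : ℂ)‖ₑ = ENNReal.ofReal (h ^ 3)⁻¹ := by
    rw [← ofReal_norm, Complex.norm_real, Real.norm_of_nonneg (by positivity)]
  rw [h7]
  gcongr
  calc _ ≤ (∫⁻ ξ, ENNReal.ofReal C * (A ξ ^ (1 / 2 : ℝ) * B ξ ^ (1 / 2 : ℝ))) ^ 2 := by
        gcongr
        exact (enorm_integral_le_lintegral_enorm _).trans (lintegral_mono_ae hfiber)
    _ = ENNReal.ofReal C ^ 2 * (∫⁻ ξ, A ξ ^ (1 / 2 : ℝ) * B ξ ^ (1 / 2 : ℝ)) ^ 2 := by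
        rw [lintegral_const_mul' _ _ ENNReal.ofReal_ne_top, mul_pow]
    _ ≤ ENNReal.ofReal C ^ 2 * ((∫⁻ ξ, A ξ) * ∫⁻ ξ, B ξ) := by
        gcongr
        have := lintegral_mul_sq_le volume (hAm.pow_const (1 / 2 : ℝ))
          (hBm.aemeasurable.pow_const (1 / 2 : ℝ))
        simpa only [h6] using this
    _ = _ := by rw [hAint]

/-- An operator whose symbol differs from that of `Op(f)` by a factor bounded by the weight `C w`
has its Hilbert-Schmidt norm bounded by the corresponding weighted norm of `f`. -/
theorem weakOpNorm_le_of_symbol (hh : 0 < h) (hf : MemLp f 2 volume) (hG : MemLp G 2 volume)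
    (hw : Measurable w)
    (hPl : ∀ᵐ ξ : X, ∀ hu : MemLp (fun x : X => f (x, ξ)) 2 volume,
      ∫⁻ η, (w η * ‖(𝓕⁻ (hu.toLp _) : L2X) η‖ₑ) ^ 2 = ∫⁻ x, ‖G (x, ξ)‖ₑ ^ 2)
    (hκ : ∀ φ ψ ξ η, κ φ ψ ξ η = m ξ η * wignerSymbol h φ ψ ξ η)
    (hC : 0 ≤ C) (hm : ∀ ξ η, ‖m ξ η‖ₑ ≤ ENNReal.ofReal C * w η)
    (hint : ∀ φ ψ, Integrable (fun z : Phase => f z * (𝓕⁻ (κ φ ψ z.2) : 𝓢(X, ℂ)) z.1) volume)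
    (hT : ∀ φ ψ, T φ ψ =
      ((h ^ 3)⁻¹ : ℝ) * ∫ z : Phase, f z * (𝓕⁻ (κ φ ψ z.2) : 𝓢(X, ℂ)) z.1) :
    weakOpNorm h T ≤ ENNReal.ofReal C * eLpNorm G 2 volume := by
  set N : ℝ := (eLpNorm G 2 volume).toReal
  have hN : eLpNorm G 2 volume = ENNReal.ofReal N := (ENNReal.ofReal_toReal hG.2.ne).symm
  have hN0 : 0 ≤ N := ENNReal.toReal_nonneg
  -- Squaring the prefactor `h⁻³` gives `h⁻⁶`, and the norm of the symbol contributes `h³`; the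
  -- remaining `h⁻³` is `r²`, and `r` cancels the `h^{3/2}` in `semiclassicalTwo`.
  set r : ℝ := (h ^ (3 / 2 : ℝ))⁻¹
  have hr : r ^ 2 = (h ^ 3)⁻¹ := by
    rw [inv_pow, ← Real.rpow_natCast, ← Real.rpow_mul hh.le]
    norm_num
  have hr0 : 0 ≤ r := by positivity
  let D : 𝓢(X, ℂ) →ₗ[ℂ] L2X := (SchwartzMap.toLpCLM ℂ ℂ 2 volume : 𝓢(X, ℂ) →L[ℂ] L2X)
  have hD : DenseRange D := SchwartzMap.denseRange_toLpCLM (F := ℂ) (E := X) (p := 2) (by norm_num)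
  have hbound : TensorBound D T (r * (C * N)) := by
    intro ι _ c φ ψ
    have h1 := enorm_sum_symbol_sq_le hh hf hG hw hPl hκ hm hint hT c φ ψ
    rw [lintegral_sum_wignerSymbol_sq hh, hN] at h1
    set Q : ℝ := (∑ i, ∑ l, c i * conj (c l) *
        (⟪(φ l).toLp 2 volume, (φ i).toLp 2 volume⟫_ℂ *
          ⟪(ψ i).toLp 2 volume, (ψ l).toLp 2 volume⟫_ℂ)).re
    change _ ≤ (r * (C * N)) ^ 2 * Q
    have h2 : 0 ≤ Q :=
      (integral_nonneg fun _ => by positivity).trans_eq (integral_sum_tensor_sq c φ ψ).2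
    have h3 : ‖∑ i, c i * T (φ i) (ψ i)‖ₑ ^ 2 =
        ENNReal.ofReal (‖∑ i, c i * T (φ i) (ψ i)‖ ^ 2) := by
      rw [← ofReal_norm, ENNReal.ofReal_pow (norm_nonneg _)]
    rw [h3, ← ENNReal.ofReal_pow (by positivity), ← ENNReal.ofReal_pow (by positivity),
      ← ENNReal.ofReal_pow (by positivity), ← ENNReal.ofReal_mul (by positivity),
      ← ENNReal.ofReal_mul (by positivity), ← ENNReal.ofReal_mul (by positivity),
      ← ENNReal.ofReal_mul (by positivity), ENNReal.ofReal_le_ofReal_iff (by positivity)] at h1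
    refine h1.trans (le_of_eq ?_)
    rw [mul_pow, hr]
    field_simp
  obtain ⟨A, hA⟩ := hbound.exists_operator (by positivity) hD
  refine (iInf₂_le A fun φ ψ => hA φ ψ).trans ?_
  rw [semiclassicalTwo, hN, ← ENNReal.ofReal_mul hC]
  calc _ ≤ ENNReal.ofReal (h ^ (3 / 2 : ℝ)) * ENNReal.ofReal (r * (C * N)) := by
        gcongr
        exact hbound.schattenTwo_le (by positivity) hD hA
    _ = ENNReal.ofReal (C * N) := by
        rw [← ENNReal.ofReal_mul (by positivity), ← mul_assoc]
        congr 1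
        rw [mul_inv_cancel₀ (by positivity), one_mul]

end SymbolBound

/-! ### The multipliers of the three differences. -/

section WeightCommutators

/-- `⟨ξ⟩ʲ f` need not be square integrable, so the weight is carried by the Wigner transform. This
makes the integrals defining the weighted quantizations absolutely convergent and allows them to be
split. -/
theorem integrable_bracket_pow_mul_wigner {h : ℝ} (hh : 0 < h) {f : Phase → ℂ}
    (hf : MemLp f 2 volume) (φ ψ : 𝓢(X, ℂ)) {j : ℕ} (hj : j ≤ 2) :
    Integrable (fun z : Phase =>
      (bracket z.2 : ℂ) ^ j * f z * wigner h (fun x y => φ x * conj (ψ y)) z) volume := by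
  refine ((memLp_bracket_pow_mul_wigner hh φ ψ hj).integrable_mul hf).congr
    (Filter.Eventually.of_forall fun z => ?_)
  simp only [Pi.mul_apply]
  ring

theorem fourierInv_smul_sub_apply (a : ℂ) (s t : 𝓢(X, ℂ)) (x : X) :
    (𝓕⁻ (a • s - t) : 𝓢(X, ℂ)) x = a * (𝓕⁻ s : 𝓢(X, ℂ)) x - (𝓕⁻ t : 𝓢(X, ℂ)) x := by
  rw [sub_eq_add_neg, FourierTransform.fourierInv_add, FourierTransform.fourierInv_smul,
    FourierTransform.fourierInv_neg]
  simp [add_apply, neg_apply, smul_apply, sub_eq_add_neg]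

theorem enorm_ofReal_le_ofReal {a b : ℝ} (h : |a| ≤ b) : ‖(a : ℂ)‖ₑ ≤ ENNReal.ofReal b := by
  rw [← ofReal_norm, Complex.norm_real]
  exact ENNReal.ofReal_le_ofReal h

/-- This is the source of the constants: the momentum shift `hη/2` equals `ħ/2` times `2πη`, and
`2π‖η‖` is the Fourier weight of the gradient. -/
theorem norm_half_smul_eq {h : ℝ} (hh : 0 < h) (η : X) :
    ‖(h / 2) • η‖ = hbar h / 2 * (2 * Real.pi * ‖η‖) := by
  rw [norm_smul, Real.norm_of_nonneg (by positivity), hbar]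
  field_simp

variable {h : ℝ} {f : Phase → ℂ} (φ ψ : 𝓢(X, ℂ))

theorem integrable_symbol_difference (hh : 0 < h) (hf : MemLp f 2 volume) {j : ℕ} (hj : j ≤ 2)
    (φ' ψ' : 𝓢(X, ℂ)) :
    Integrable (fun z : Phase => f z * (𝓕⁻ ((bracket z.2 : ℂ) ^ j • wignerSymbol h φ ψ z.2 -
      wignerSymbol h φ' ψ' z.2) : 𝓢(X, ℂ)) z.1) volume := by
  refine ((integrable_bracket_pow_mul_wigner hh hf φ ψ hj).sub
    (integrable_bracket_pow_mul_wigner hh hf φ' ψ' (zero_le : 0 ≤ 2))).congr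
    (Filter.Eventually.of_forall fun z => ?_)
  simp only [Pi.sub_apply, fourierInv_smul_sub_apply, wigner_eq_fourierInv]
  ring

theorem weyl_sub_weyl_eq (hh : 0 < h) (hf : MemLp f 2 volume) {j : ℕ} (hj : j ≤ 2)
    (φ' ψ' : 𝓢(X, ℂ)) :
    weyl h (fun z => (bracket z.2 : ℂ) ^ j * f z) φ ψ - weyl h f φ' ψ' =
      ((h ^ 3)⁻¹ : ℝ) * ∫ z : Phase, f z * (𝓕⁻ ((bracket z.2 : ℂ) ^ j • wignerSymbol h φ ψ z.2 -
        wignerSymbol h φ' ψ' z.2) : 𝓢(X, ℂ)) z.1 := by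
  have h1 := integrable_bracket_pow_mul_wigner hh hf φ ψ hj
  have h2 : Integrable (fun z : Phase => f z * wigner h (fun x y => φ' x * conj (ψ' y)) z) volume :=
    (integrable_bracket_pow_mul_wigner hh hf φ' ψ' (zero_le : 0 ≤ 2)).congr
      (Filter.Eventually.of_forall fun z => by simp only [pow_zero, one_mul])
  rw [weyl, weyl, ← mul_sub, ← integral_sub h1 h2]
  congr 1
  refine integral_congr_ae (Filter.Eventually.of_forall fun z => ?_)
  simp only [fourierInv_smul_sub_apply, wigner_eq_fourierInv]
  ring

theorem measurable_gradient_weight :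
    Measurable fun η : X => ENNReal.ofReal (2 * Real.pi * ‖η‖) := by
  fun_prop

/-- The multiplier is `⟨ξ⟩ - ⟨ξ + hη/2⟩`, controlled by the Lipschitz bound for the bracket. -/
theorem weakOpNorm_sub_mulBracketP_le (hh : 0 < h) (hf : MemLp f 2 volume)
    {G : Phase → EuclideanSpace ℂ (Fin 3)} (hG : MemLp G 2 volume) (hfG : IsWeakGradX f G) :
    weakOpNorm h (weyl h (fun z => (bracket z.2 : ℂ) * f z) - mulBracketP h (weyl h f)) ≤
      ENNReal.ofReal (hbar h / 2) * eLpNorm G 2 volume := by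
  refine weakOpNorm_le_of_symbol hh hf hG measurable_gradient_weight
    (hfG.ae_lintegral_fourierInv hf hG)
    (κ := fun φ ψ ξ => (bracket ξ : ℂ) ^ 1 • wignerSymbol h φ ψ ξ
      - wignerSymbol h (bracketP h φ) ψ ξ)
    (m := fun ξ η => ((bracket ξ - bracket (ξ + (h / 2) • η) : ℝ) : ℂ)) ?_
    (by unfold hbar; positivity) ?_ ?_ ?_
  · intro φ ψ ξ η
    rw [sub_apply, smul_apply, wignerSymbol_bracketP_left hh.ne', smul_eq_mul]
    push_cast
    ring
  · intro ξ η
    rw [← ENNReal.ofReal_mul (by unfold hbar; positivity), ← norm_half_smul_eq hh]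
    refine enorm_ofReal_le_ofReal ((abs_bracket_sub_le _ _).trans_eq ?_)
    rw [sub_add_cancel_left, norm_neg]
  · exact fun φ ψ => integrable_symbol_difference φ ψ hh hf one_le_two _ _
  · intro φ ψ
    rw [← weyl_sub_weyl_eq φ ψ hh hf one_le_two]
    simp only [pow_one]
    rfl

/-- With `⟨p⟩` acting on `ψ`, the momentum shift is `-hη/2` and the Lipschitz bound is the same. -/
theorem weakOpNorm_sub_bracketPMul_le (hh : 0 < h) (hf : MemLp f 2 volume)
    {G : Phase → EuclideanSpace ℂ (Fin 3)} (hG : MemLp G 2 volume) (hfG : IsWeakGradX f G) :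
    weakOpNorm h (weyl h (fun z => (bracket z.2 : ℂ) * f z) - bracketPMul h (weyl h f)) ≤
      ENNReal.ofReal (hbar h / 2) * eLpNorm G 2 volume := by
  refine weakOpNorm_le_of_symbol hh hf hG measurable_gradient_weight
    (hfG.ae_lintegral_fourierInv hf hG)
    (κ := fun φ ψ ξ => (bracket ξ : ℂ) ^ 1 • wignerSymbol h φ ψ ξ
      - wignerSymbol h φ (bracketP h ψ) ξ)
    (m := fun ξ η => ((bracket ξ - bracket (ξ - (h / 2) • η) : ℝ) : ℂ)) ?_
    (by unfold hbar; positivity) ?_ ?_ ?_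
  · intro φ ψ ξ η
    rw [sub_apply, smul_apply, wignerSymbol_bracketP_right hh.ne', smul_eq_mul]
    push_cast
    ring
  · intro ξ η
    rw [← ENNReal.ofReal_mul (by unfold hbar; positivity), ← norm_half_smul_eq hh]
    refine enorm_ofReal_le_ofReal ((abs_bracket_sub_le _ _).trans_eq ?_)
    rw [sub_sub_cancel]
  · exact fun φ ψ => integrable_symbol_difference φ ψ hh hf one_le_two _ _
  · intro φ ψ
    rw [← weyl_sub_weyl_eq φ ψ hh hf one_le_two]
    simp only [pow_one]
    rfl

/-- The first order terms cancel between the shifts `±hη/2`, so `abs_bracket_mul_sub_le` gives a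
multiplier quadratic in `hη/2`. -/
theorem weakOpNorm_bracketP_conj_sub_le (hh : 0 < h) (hf : MemLp f 2 volume)
    {g : Phase → ℂ} (hg : MemLp g 2 volume) (hfg : IsWeakLaplacianX f g) :
    weakOpNorm h (bracketPMul h (mulBracketP h (weyl h f))
        - weyl h (fun z => (bracket z.2 : ℂ) ^ 2 * f z)) ≤
      ENNReal.ofReal (hbar h ^ 2 / 4) * eLpNorm g 2 volume := by
  -- The difference appears here in the order opposite to `weyl_sub_weyl_eq`, hence the sign.
  have hκ : ∀ φ ψ ξ, wignerSymbol h (bracketP h φ) (bracketP h ψ) ξ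
      - (bracket ξ : ℂ) ^ 2 • wignerSymbol h φ ψ ξ = (-1 : ℂ) • ((bracket ξ : ℂ) ^ 2 •
        wignerSymbol h φ ψ ξ - wignerSymbol h (bracketP h φ) (bracketP h ψ) ξ) := by
    intro φ ψ ξ
    rw [neg_one_smul, neg_sub]
  have hFκ : ∀ φ ψ, ∀ z : Phase, f z * (𝓕⁻ (wignerSymbol h (bracketP h φ) (bracketP h ψ) z.2
      - (bracket z.2 : ℂ) ^ 2 • wignerSymbol h φ ψ z.2) : 𝓢(X, ℂ)) z.1 =
      -(f z * (𝓕⁻ ((bracket z.2 : ℂ) ^ 2 • wignerSymbol h φ ψ z.2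
        - wignerSymbol h (bracketP h φ) (bracketP h ψ) z.2) : 𝓢(X, ℂ)) z.1) := by
    intro φ ψ z
    rw [hκ, FourierTransform.fourierInv_smul, smul_apply, smul_eq_mul]
    ring
  refine weakOpNorm_le_of_symbol hh hf hg
    (by fun_prop : Measurable fun η : X => ENNReal.ofReal ((2 * Real.pi * ‖η‖) ^ 2))
    (hfg.ae_lintegral_fourierInv hf hg)
    (κ := fun φ ψ ξ => wignerSymbol h (bracketP h φ) (bracketP h ψ) ξ
      - (bracket ξ : ℂ) ^ 2 • wignerSymbol h φ ψ ξ)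
    (m := fun ξ η => ((bracket (ξ + (h / 2) • η) * bracket (ξ - (h / 2) • η)
      - bracket ξ ^ 2 : ℝ) : ℂ)) ?_ (by positivity) ?_ ?_ ?_
  · intro φ ψ ξ η
    rw [sub_apply, smul_apply, wignerSymbol_bracketP_left hh.ne',
      wignerSymbol_bracketP_right hh.ne', smul_eq_mul]
    push_cast
    ring
  · intro ξ η
    rw [← ENNReal.ofReal_mul (by positivity)]
    refine enorm_ofReal_le_ofReal ((abs_bracket_mul_sub_le _ _).trans_eq ?_)
    rw [norm_half_smul_eq hh]
    ring
  · intro φ ψ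
    simp_rw [hFκ]
    exact (integrable_symbol_difference φ ψ hh hf le_rfl _ _).neg
  · intro φ ψ
    simp_rw [hFκ]
    rw [integral_neg, mul_neg, ← weyl_sub_weyl_eq φ ψ hh hf le_rfl, neg_sub]
    rfl

/-- Passing a bound to the infimum over representatives of a weak derivative. -/
theorem le_mul_iInf_eLpNorm {ε : Type*} [NormedAddCommGroup ε] {P : (Phase → ε) → Prop}
    {N : ℝ≥0∞} {C : ℝ} (hC : 0 < C)
    (hm : ∀ G, P G → AEStronglyMeasurable G volume)
    (h : ∀ G, P G → MemLp G 2 volume → N ≤ ENNReal.ofReal C * eLpNorm G 2 volume) :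
    N ≤ ENNReal.ofReal C * ⨅ (G : Phase → ε) (_ : P G), eLpNorm G 2 volume := by
  -- Positivity matters because `0 * ∞ = 0`: with a positive constant the right-hand side is `∞`
  -- when no weak derivative lies in `L²`, and the bound is then trivial.
  have hC0 : ENNReal.ofReal C ≠ 0 := by simpa using hC
  simp_rw [ENNReal.mul_iInf_of_ne hC0 ENNReal.ofReal_ne_top]
  refine le_iInf₂ fun G hG => ?_
  by_cases htop : eLpNorm G 2 volume = ⊤
  · rw [htop, ENNReal.mul_top hC0]
    exact le_top
  · exact h G hG ⟨hm G hG, lt_top_iff_ne_top.2 htop⟩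

theorem IsWeakGradX.aestronglyMeasurable {f : Phase → ℂ} {G : Phase → EuclideanSpace ℂ (Fin 3)}
    (h : IsWeakGradX f G) : AEStronglyMeasurable G volume := by
  have h1 : AEMeasurable (fun z i => G z i) volume :=
    aemeasurable_pi_lambda _ fun i => (h i).2.1.aestronglyMeasurable.aemeasurable
  exact ((PiLp.continuous_toLp 2 _).measurable.comp_aemeasurable h1).aestronglyMeasurable

end WeightCommutators

end WeylWeight

end

/-! ### The three estimates, by taking infima over weak gradients and Laplacians. -/

theorem lemma3p2 (h : ℝ) (hh : 0 < h) (f : WeylWeight.Phase → ℂ) (hf : WeylWeight.MemH1 f) :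
    WeylWeight.weakOpNorm h
        (WeylWeight.weyl h (fun z => (WeylWeight.bracket z.2 : ℂ) * f z)
          - WeylWeight.mulBracketP h (WeylWeight.weyl h f))
      ≤ ENNReal.ofReal (WeylWeight.hbar h / 2) * WeylWeight.normGradX f ∧
    WeylWeight.weakOpNorm h
        (WeylWeight.weyl h (fun z => (WeylWeight.bracket z.2 : ℂ) * f z)
          - WeylWeight.bracketPMul h (WeylWeight.weyl h f))
      ≤ ENNReal.ofReal (WeylWeight.hbar h / 2) * WeylWeight.normGradX f ∧
    WeylWeight.weakOpNorm h
        (WeylWeight.bracketPMul h (WeylWeight.mulBracketP h (WeylWeight.weyl h f))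
          - WeylWeight.weyl h (fun z => (WeylWeight.bracket z.2 : ℂ) ^ 2 * f z))
      ≤ ENNReal.ofReal (WeylWeight.hbar h ^ 2 / 4) * WeylWeight.normLaplacianX f := by
  refine ⟨?_, ?_, ?_⟩
  · exact WeylWeight.le_mul_iInf_eLpNorm (by unfold WeylWeight.hbar; positivity)
      (fun G hG => hG.aestronglyMeasurable)
      fun G hG hG2 => WeylWeight.weakOpNorm_sub_mulBracketP_le hh hf.1 hG2 hG
  · exact WeylWeight.le_mul_iInf_eLpNorm (by unfold WeylWeight.hbar; positivity)
      (fun G hG => hG.aestronglyMeasurable)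
      fun G hG hG2 => WeylWeight.weakOpNorm_sub_bracketPMul_le hh hf.1 hG2 hG
  · exact WeylWeight.le_mul_iInf_eLpNorm (by unfold WeylWeight.hbar; positivity)
      (fun g hg => hg.2.1.aestronglyMeasurable)
      fun g hg hg2 => WeylWeight.weakOpNorm_bracketP_conj_sub_le hh hf.1 hg2 hg
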